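/- Let $(N_1,g_1),(N_2,g_2)$ be nonempty Riemannian manifolds of positive dimensions $n_1,n_2$, and let $(M_1,\tilde g_1),(M_2,\tilde g_2)$ be Riemannian manifolds (all manifolds smooth, finite-dimensional and without boundary). Let $\rho_i$ be a positive smooth function on $M_i$, let $\phi_i:(N_i,g_i)\to(M_i,\tilde g_i)$ be an isometric immersion, and put $f_i=\rho_i\circ\phi_i$ ($i=1,2$). Equip $N_1\times N_2$ and $M_1\times M_2$ with the doubly warped product metrics $$g=(f_2\circ\pi_2)^2\,\pi_1^*g_1+(f_1\circ\pi_1)^2\,\pi_2^*g_2,\qquad \tilde g=(\rho_2\circ\pi_2)^2\,\pi_1^*\tilde g_1+(\rho_1\circ\pi_1)^2\,\pi_2^*\tilde g_2,$$ where $\pi_i$ denotes the projection to the $i$-th factor, so that $\phi=(\phi_1,\phi_2):(N_1\times N_2,g)\to(M_1\times M_2,\tilde g)$, $\phi(x_1,x_2)=(\phi_1(x_1),\phi_2(x_2))$, is an isometric immersion (a doubly warped product immersion). For an isometric immersion $\psi:N\to M$ with second fundamental form $h$, the shape operator $A_\eta$ of a normal vector $\eta$ is given by $\langle A_\eta X,Y\rangle=\langle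 h(X,Y),\eta\rangle$, the mean curvature vector is $\mathbf H^\psi=\frac{1}{\dim N}\operatorname{trace}h$, and, for a smooth function $f$ on $M$, $Df$ denotes the normal component along $\psi$ of the gradient of $f$. The immersion $\psi$ is totally umbilical if for every smooth normal vector field $\eta$ along $\psi$ on an open set $U\subseteq N$ there is a smooth function $\lambda$ on $U$ with $A_\eta=\lambda I$ on $U$. Then the following are equivalent: 1. $\phi$ is totally umbilical with mean curvature vector $\mathbf H^\phi=-\big(D\ln(\rho_1\circ\pi_1)+D\ln(\rho_2\circ\pi_2)\big)$, where $D$ is taken with respect to $\phi$ and the metric $\tilde g$; 2. $\phi_1$ and $\phi_2$ are both totally umbilical, with mean curvature vectors $\mathbf H^{\phi_1}=-D\ln\rho_1$ and $\mathbf H^{\phi_2}=-D\ln\rho_2$ respectively, where $D$ is taken with respect to $\phi_i$ and the metric $\tilde g_i$. -/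

import Mathlib

open scoped Manifold ContDiff
open Bundle (ContMDiffRiemannianMetric TotalSpace Trivialization)

set_option linter.unusedSectionVars false

noncomputable section

namespace DoublyWarped

section Basic

variable {E : Type*} [NormedAddCommGroup E] [NormedSpace ℝ E] [FiniteDimensional ℝ E]
  {H : Type*} [TopologicalSpace H] {I : ModelWithCorners ℝ E H}
  {M : Type*} [TopologicalSpace M] [ChartedSpace H M] [IsManifold I ∞ M]

/-- Smooth Riemannian metrics on the manifold `M` (smooth symmetric positive definite sections of
`T^*M ⊗ T^*M`). -/
abbrev RiemMetric {E : Type*} [NormedAddCommGroup E] [NormedSpace ℝ E]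
    {H : Type*} [TopologicalSpace H] (I : ModelWithCorners ℝ E H)
    (M : Type*) [TopologicalSpace M] [ChartedSpace H M] [IsManifold I ∞ M] : Type _ :=
  ContMDiffRiemannianMetric I ∞ E (TangentSpace I : M → Type _)

instance (p : M) : FiniteDimensional ℝ (TangentSpace I p) :=
  inferInstanceAs (FiniteDimensional ℝ E)

theorem metric_self_nonneg (g : RiemMetric I M) (p : M) (v : TangentSpace I p) :
    0 ≤ g.inner p v v := by
  by_cases h : v = 0
  · rw [h, map_zero]
  · exact (g.pos p v h).le

/-- The musical isomorphism `v ↦ g(v, ·)` of a tangent space onto its dual. -/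
def flat (g : RiemMetric I M) (p : M) : TangentSpace I p ≃ₗ[ℝ] Module.Dual ℝ (TangentSpace I p) :=
  LinearEquiv.ofBijective
    { toFun := fun v => (g.inner p v).toLinearMap
      map_add' := fun v w => by ext z; simp
      map_smul' := fun c v => by ext z; simp }
    (by
      have hinj : Function.Injective
          ({ toFun := fun v => (g.inner p v).toLinearMap
             map_add' := fun v w => by ext z; simp
             map_smul' := fun c v => by ext z; simp } :
            TangentSpace I p →ₗ[ℝ] Module.Dual ℝ (TangentSpace I p)) := by
        rw [← LinearMap.ker_eq_bot, LinearMap.ker_eq_bot']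
        intro v hv
        by_contra h
        have h1 := g.pos p v h
        have h2 : g.inner p v v = 0 := by
          have := congrArg (fun l : Module.Dual ℝ (TangentSpace I p) => l v) hv
          simpa using this
        exact absurd h2 h1.ne'
      refine ⟨hinj, ?_⟩
      exact (LinearMap.injective_iff_surjective_of_finrank_eq_finrank
        (Subspace.dual_finrank_eq).symm).1 hinj)

/-- The inverse musical isomorphism. -/
def sharp (g : RiemMetric I M) (p : M) : Module.Dual ℝ (TangentSpace I p) ≃ₗ[ℝ] TangentSpace I p :=
  (flat g p).symm

theorem inner_sharp (g : RiemMetric I M) (p : M) (α : Module.Dual ℝ (TangentSpace I p))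
    (v : TangentSpace I p) : g.inner p (sharp g p α) v = α v :=
  congrArg (fun l : Module.Dual ℝ (TangentSpace I p) => l v) ((flat g p).apply_symm_apply α)

/-- The gradient of `f`: the vector with `g(grad f, v) = df(v)`. -/
def gradient (g : RiemMetric I M) (f : M → ℝ) (p : M) : TangentSpace I p :=
  sharp g p (mfderiv I 𝓘(ℝ, ℝ) f p).toLinearMap

end Basic

section Pullback
variable {E : Type*} [NormedAddCommGroup E] [NormedSpace ℝ E]
  {H : Type*} [TopologicalSpace H] {I : ModelWithCorners ℝ E H}
  {N : Type*} [TopologicalSpace N] [ChartedSpace H N] [IsManifold I ∞ N]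
  {F : Type*} [NormedAddCommGroup F] [NormedSpace ℝ F]
  {K : Type*} [TopologicalSpace K] {J : ModelWithCorners ℝ F K}
  {M : Type*} [TopologicalSpace M] [ChartedSpace K M] [IsManifold J ∞ M]

/-- The pullback `φ^* g` of a Riemannian metric along a map. -/
def pullback (g : RiemMetric J M) (φ : N → M) (p : N) :
    TangentSpace I p →L[ℝ] TangentSpace I p →L[ℝ] ℝ :=
  ((mfderiv I J φ p).precomp ℝ).comp ((g.inner (φ p)).comp (mfderiv I J φ p))

theorem pullback_apply (g : RiemMetric J M) (φ : N → M) (p : N) (v w : TangentSpace I p) :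
    pullback g φ p v w = g.inner (φ p) (mfderiv I J φ p v) (mfderiv I J φ p w) := rfl

/-- A family of bilinear forms that is smooth in local trivializations is a smooth section. -/
theorem contMDiff_section_bilin {Φ : ∀ p : N, TangentSpace I p →L[ℝ] TangentSpace I p →L[ℝ] ℝ}
    (C : N → N → E →L[ℝ] E →L[ℝ] ℝ)
    (hC : ∀ p₀, ContMDiffAt I 𝓘(ℝ, E →L[ℝ] E →L[ℝ] ℝ) ∞ (C p₀) p₀)
    (h : ∀ p₀, ∀ᶠ p in nhds p₀, ∀ v w, C p₀ p v w =
      Φ p ((trivializationAt E (TangentSpace I) p₀).symm p v)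
        ((trivializationAt E (TangentSpace I) p₀).symm p w)) :
    ContMDiff I (I.prod 𝓘(ℝ, E →L[ℝ] E →L[ℝ] ℝ)) ∞
      (fun p ↦ TotalSpace.mk' (E →L[ℝ] E →L[ℝ] ℝ)
        (E := fun p : N ↦ TangentSpace I p →L[ℝ] TangentSpace I p →L[ℝ] ℝ) p (Φ p)) := by
  intro p₀
  rw [contMDiffAt_hom_bundle]
  refine ⟨contMDiffAt_id, (hC p₀).congr_of_eventuallyEq ?_⟩
  have hs : (trivializationAt E (TangentSpace I) p₀).baseSet ∈ nhds p₀ :=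
    (trivializationAt E (TangentSpace I) p₀).open_baseSet.mem_nhds
      (FiberBundle.mem_baseSet_trivializationAt' p₀)
  filter_upwards [h p₀, hs] with p hp hps
  ext v w
  rw [hp v w]
  have := inCoordinates_apply_eq₂ (𝕜 := ℝ) (F₁ := E) (E₁ := (TangentSpace I : N → Type _)) (F₂ := E)
    (E₂ := (TangentSpace I : N → Type _)) (F₃ := ℝ) (E₃ := Bundle.Trivial N ℝ) (x₀ := p₀)
    (x := p) (ϕ := Φ p) (v := v) (w := w) hps hps (by simp)
  refine Eq.trans this ?_
  simp

theorem contMDiff_metric_coord (g : RiemMetric J M) (q₀ : M) :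
    ∃ C : M → F →L[ℝ] F →L[ℝ] ℝ, ContMDiffAt J 𝓘(ℝ, F →L[ℝ] F →L[ℝ] ℝ) ∞ C q₀ ∧
      ∀ᶠ q in nhds q₀, ∀ v w, C q v w =
      g.inner q ((trivializationAt F (TangentSpace J) q₀).symm q v)
        ((trivializationAt F (TangentSpace J) q₀).symm q w) := by
  have h := (contMDiffAt_hom_bundle _).1 (g.contMDiff q₀)
  refine ⟨_, h.2, ?_⟩
  have hs : (trivializationAt F (TangentSpace J) q₀).baseSet ∈ nhds q₀ :=
    (trivializationAt F (TangentSpace J) q₀).open_baseSet.mem_nhds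
      (FiberBundle.mem_baseSet_trivializationAt' q₀)
  filter_upwards [hs] with q hq v w
  have := inCoordinates_apply_eq₂ (𝕜 := ℝ) (F₁ := F) (E₁ := (TangentSpace J : M → Type _)) (F₂ := F)
    (E₂ := (TangentSpace J : M → Type _)) (F₃ := ℝ) (E₃ := Bundle.Trivial M ℝ) (x₀ := q₀)
    (x := q) (ϕ := g.inner q) (v := v) (w := w) hq hq (by simp)
  refine Eq.trans this ?_
  simp

theorem contMDiff_pullback_coord (g : RiemMetric J M) {φ : N → M} (hφ : ContMDiff I J ∞ φ) (p₀ : N) :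
    ∃ C : N → E →L[ℝ] E →L[ℝ] ℝ, ContMDiffAt I 𝓘(ℝ, E →L[ℝ] E →L[ℝ] ℝ) ∞ C p₀ ∧
      ∀ᶠ p in nhds p₀, ∀ v w, C p v w =
      pullback (I := I) g φ p ((trivializationAt E (TangentSpace I) p₀).symm p v)
        ((trivializationAt E (TangentSpace I) p₀).symm p w) := by
  obtain ⟨C, hC, hCe⟩ := contMDiff_metric_coord g (φ p₀)
  have hD := (hφ p₀).mfderiv_const (m := ∞) le_rfl
  have hs : (trivializationAt E (TangentSpace I) p₀).baseSet ∈ nhds p₀ :=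
    (trivializationAt E (TangentSpace I) p₀).open_baseSet.mem_nhds
      (FiberBundle.mem_baseSet_trivializationAt' p₀)
  have hs' : (trivializationAt F (TangentSpace J) (φ p₀)).baseSet ∈ nhds (φ p₀) :=
    (trivializationAt F (TangentSpace J) (φ p₀)).open_baseSet.mem_nhds
      (FiberBundle.mem_baseSet_trivializationAt' (φ p₀))
  have hc := hφ.continuous.continuousAt (x := p₀)
  let A : N → E →L[ℝ] F := inTangentCoordinates I J id φ (mfderiv I J φ) p₀
  refine ⟨fun p => ((ContinuousLinearMap.compL ℝ E F ℝ).flip (A p)).comp ((C (φ p)).comp (A p)),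
    ?_, ?_⟩
  · have hCφ := hC.comp p₀ (hφ p₀)
    have h2 := hCφ.clm_comp hD
    have h3 := hD.clm_precomp (F₃ := ℝ)
    exact h3.clm_comp h2
  · filter_upwards [hs, hc.preimage_mem_nhds hs', hc.eventually hCe] with p hp hp' hCp v w
    rw [pullback_apply]
    have key : ∀ u : E, (trivializationAt F (TangentSpace J) (φ p₀)).symm (φ p)
        (A p u) =
        mfderiv I J φ p ((trivializationAt E (TangentSpace I) p₀).symm p u) := by
      intro u
      have : A p u =
        (trivializationAt F (TangentSpace J) (φ p₀)).continuousLinearMapAt ℝ (φ p)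
          (mfderiv I J φ p ((trivializationAt E (TangentSpace I) p₀).symm p u)) := by
        rw [← (trivializationAt E (TangentSpace I) p₀).symmL_apply (R := ℝ) hp u]
        simp [A, inTangentCoordinates, ContinuousLinearMap.inCoordinates]
      rw [this]
      have h := (trivializationAt F (TangentSpace J) (φ p₀)).symmL_continuousLinearMapAt (R := ℝ) hp'
        (mfderiv I J φ p ((trivializationAt E (TangentSpace I) p₀).symm p u))
      rwa [Trivialization.symmL_apply (hb := hp')] at h
    rw [← key, ← key]
    exact hCp _ _

end Pullback

/-- Positive smooth functions on a manifold. -/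
structure WarpingFunction {E : Type*} [NormedAddCommGroup E] [NormedSpace ℝ E]
    {H : Type*} [TopologicalSpace H] (I : ModelWithCorners ℝ E H)
    (M : Type*) [TopologicalSpace M] [ChartedSpace H M] where
  toFun : M → ℝ
  contMDiff : ContMDiff I 𝓘(ℝ, ℝ) ∞ toFun
  pos : ∀ x, 0 < toFun x

/-- The function `ρ ∘ φ`. -/
def WarpingFunction.comp {E : Type*} [NormedAddCommGroup E] [NormedSpace ℝ E]
    {H : Type*} [TopologicalSpace H] {I : ModelWithCorners ℝ E H}
    {N : Type*} [TopologicalSpace N] [ChartedSpace H N]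
    {F : Type*} [NormedAddCommGroup F] [NormedSpace ℝ F]
    {K : Type*} [TopologicalSpace K] {J : ModelWithCorners ℝ F K}
    {M : Type*} [TopologicalSpace M] [ChartedSpace K M]
    (ρ : WarpingFunction J M) (φ : N → M) (hφ : ContMDiff I J ∞ φ) : WarpingFunction I N where
  toFun := ρ.toFun ∘ φ
  contMDiff := ρ.contMDiff.comp hφ
  pos x := ρ.pos (φ x)

section Product

variable {E₁ : Type*} [NormedAddCommGroup E₁] [NormedSpace ℝ E₁] [FiniteDimensional ℝ E₁]
  {H₁ : Type*} [TopologicalSpace H₁] {I₁ : ModelWithCorners ℝ E₁ H₁}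
  {M₁ : Type*} [TopologicalSpace M₁] [ChartedSpace H₁ M₁] [IsManifold I₁ ∞ M₁]
  {E₂ : Type*} [NormedAddCommGroup E₂] [NormedSpace ℝ E₂] [FiniteDimensional ℝ E₂]
  {H₂ : Type*} [TopologicalSpace H₂] {I₂ : ModelWithCorners ℝ E₂ H₂}
  {M₂ : Type*} [TopologicalSpace M₂] [ChartedSpace H₂ M₂] [IsManifold I₂ ∞ M₂]

/-- A positive definite bilinear form on a finite-dimensional space has bounded unit ball. -/
theorem isVonNBounded_of_pos {E : Type*} [NormedAddCommGroup E] [NormedSpace ℝ E]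
    [FiniteDimensional ℝ E] (B : E →L[ℝ] E →L[ℝ] ℝ) (hB : ∀ v, v ≠ 0 → 0 < B v v) :
    Bornology.IsVonNBounded ℝ {v : E | B v v < 1} := by
  rw [NormedSpace.isVonNBounded_iff]
  rcases subsingleton_or_nontrivial E with h | h
  · exact (Set.toFinite _).isBounded
  have hc : Continuous fun v : E => B v v := by fun_prop
  obtain ⟨u, hu, hmin⟩ := (isCompact_sphere (0 : E) 1).exists_isMinOn
    (NormedSpace.sphere_nonempty.2 zero_le_one) hc.continuousOn
  have hu1 : ‖u‖ = 1 := by simpa using hu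
  have hpos : 0 < B u u := hB u (by rintro rfl; simp at hu1)
  refine isBounded_iff_forall_norm_le.2 ⟨Real.sqrt (1 / B u u), fun v hv => ?_⟩
  rcases eq_or_ne v 0 with rfl | hv0
  · simp
  have hn : 0 < ‖v‖ := norm_pos_iff.2 hv0
  have h1 : B u u ≤ B (‖v‖⁻¹ • v) (‖v‖⁻¹ • v) := hmin (by
    simp [norm_smul, hn.ne'])
  have h2 : B (‖v‖⁻¹ • v) (‖v‖⁻¹ • v) * ‖v‖ ^ 2 = B v v := by
    simp only [map_smul, smul_apply, smul_eq_mul]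
    field_simp
  apply Real.le_sqrt_of_sq_le
  rw [le_div_iff₀ hpos]
  have h3 : B v v < 1 := hv
  nlinarith [sq_nonneg ‖v‖]

theorem doublyWarpedForm_pos (g₁ : RiemMetric I₁ M₁) (g₂ : RiemMetric I₂ M₂)
    (f₁ : WarpingFunction I₁ M₁) (f₂ : WarpingFunction I₂ M₂) (p : M₁ × M₂)
    (v : TangentSpace (I₁.prod I₂) p) (hv : v ≠ 0) :
    0 < ((f₂.toFun p.2) ^ 2 • pullback (I := I₁.prod I₂) g₁ Prod.fst p +
      (f₁.toFun p.1) ^ 2 • pullback (I := I₁.prod I₂) g₂ Prod.snd p) v v := by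
  have e : ((f₂.toFun p.2) ^ 2 • pullback (I := I₁.prod I₂) g₁ Prod.fst p +
      (f₁.toFun p.1) ^ 2 • pullback (I := I₁.prod I₂) g₂ Prod.snd p) v v =
      (f₂.toFun p.2) ^ 2 * g₁.inner p.1 v.1 v.1 + (f₁.toFun p.1) ^ 2 * g₂.inner p.2 v.2 v.2 := by
    simp only [add_apply, smul_apply, pullback_apply, mfderiv_fst, mfderiv_snd, smul_eq_mul]
    rfl
  rw [e]
  have hf₁ := pow_pos (f₁.pos p.1) 2
  have hf₂ := pow_pos (f₂.pos p.2) 2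
  have n₁ := metric_self_nonneg g₁ p.1 v.1
  have n₂ := metric_self_nonneg g₂ p.2 v.2
  by_cases h : v.1 = 0
  · have h2 : v.2 ≠ 0 := fun h2 => hv (Prod.ext h h2)
    have := mul_pos hf₁ (g₂.pos p.2 _ h2)
    have := mul_nonneg hf₂.le n₁
    linarith
  · have := mul_pos hf₂ (g₁.pos p.1 _ h)
    have := mul_nonneg hf₁.le n₂
    linarith

/-- The doubly warped product metric `(f₂ ∘ π₂)² π₁^* g₁ + (f₁ ∘ π₁)² π₂^* g₂` on `M₁ × M₂`. -/
def doublyWarped (g₁ : RiemMetric I₁ M₁) (g₂ : RiemMetric I₂ M₂)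
    (f₁ : WarpingFunction I₁ M₁) (f₂ : WarpingFunction I₂ M₂) :
    RiemMetric (I₁.prod I₂) (M₁ × M₂) where
  inner p := (f₂.toFun p.2) ^ 2 • pullback (I := I₁.prod I₂) g₁ Prod.fst p +
    (f₁.toFun p.1) ^ 2 • pullback (I := I₁.prod I₂) g₂ Prod.snd p
  symm p v w := by
    simp only [add_apply, smul_apply, pullback_apply, g₁.symm p.1 (mfderiv _ I₁ Prod.fst p v),
      g₂.symm p.2 (mfderiv _ I₂ Prod.snd p v)]
  pos p v hv := doublyWarpedForm_pos g₁ g₂ f₁ f₂ p v hv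
  isVonNBounded p := isVonNBounded_of_pos (E := E₁ × E₂)
    ((f₂.toFun p.2) ^ 2 • pullback (I := I₁.prod I₂) g₁ Prod.fst p +
      (f₁.toFun p.1) ^ 2 • pullback (I := I₁.prod I₂) g₂ Prod.snd p)
    (doublyWarpedForm_pos g₁ g₂ f₁ f₂ p)
  contMDiff := by
    choose C₁ hC₁ hC₁e using fun p₀ : M₁ × M₂ =>
      contMDiff_pullback_coord (I := I₁.prod I₂) g₁ (contMDiff_fst (N := M₂) (J := I₂)) p₀
    choose C₂ hC₂ hC₂e using fun p₀ : M₁ × M₂ =>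
      contMDiff_pullback_coord (I := I₁.prod I₂) g₂ (contMDiff_snd (M := M₁) (I := I₁)) p₀
    refine contMDiff_section_bilin
      (fun p₀ p => (f₂.toFun p.2) ^ 2 • C₁ p₀ p + (f₁.toFun p.1) ^ 2 • C₂ p₀ p)
      (fun p₀ => ?_) (fun p₀ => ?_)
    · have h1 := ((f₁.contMDiff.comp (contMDiff_fst (N := M₂) (J := I₂))).pow 2) p₀
      have h2 := ((f₂.contMDiff.comp (contMDiff_snd (M := M₁) (I := I₁))).pow 2) p₀
      exact (h2.smul (hC₁ p₀)).add (h1.smul (hC₂ p₀))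
    · filter_upwards [hC₁e p₀, hC₂e p₀] with p h1 h2 v w
      simp [h1, h2]

end Product

section LeviCivita

variable {E : Type*} [NormedAddCommGroup E] [NormedSpace ℝ E] [FiniteDimensional ℝ E]
  {H : Type*} [TopologicalSpace H] {I : ModelWithCorners ℝ E H}
  {N : Type*} [TopologicalSpace N] [ChartedSpace H N] [IsManifold I ∞ N]
  {F : Type*} [NormedAddCommGroup F] [NormedSpace ℝ F] [FiniteDimensional ℝ F]
  {K : Type*} [TopologicalSpace K] {J : ModelWithCorners ℝ F K}
  {M : Type*} [TopologicalSpace M] [ChartedSpace K M] [IsManifold J ∞ M]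

variable (I) in
/-- The differential at `q` of the chart around `p`, which sends a tangent vector at `q` to its
components in that chart. -/
def chartCoord (p q : N) : TangentSpace I q →L[ℝ] E :=
  mfderiv I 𝓘(ℝ, E) (extChartAt I p) q

variable (I) in
/-- The differential at `y` of the inverse of the chart around `p`, which sends components in that
chart to a tangent vector at the point with coordinates `y`. -/
def chartFrame (p : N) (y : E) : E →L[ℝ] TangentSpace I ((extChartAt I p).symm y) :=
  mfderiv 𝓘(ℝ, E) I (extChartAt I p).symm y

variable (I) in
/-- `chartFrame` at the centre `p` of the chart: components in the chart around `p` to tangent vectors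
at `p`. -/
def frameAt (p : N) : E →L[ℝ] TangentSpace I p :=
  chartFrame I p (extChartAt I p p)

/-- The metric in the chart around `p`: the bilinear form with matrix `(g_{ij}(y))`. -/
def chartMetric (g : RiemMetric I N) (p : N) (y : E) : E →L[ℝ] E →L[ℝ] ℝ :=
  ((chartFrame I p y).precomp ℝ).comp ((g.inner ((extChartAt I p).symm y)).comp (chartFrame I p y))

/-- `chartMetricDeriv g p a b c` is `(∂_a g)(b, c)`, in the chart around `p` and at the point `p`. -/
def chartMetricDeriv (g : RiemMetric I N) (p : N) : E →L[ℝ] E →L[ℝ] E →L[ℝ] ℝ :=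
  fderiv ℝ (chartMetric g p) (extChartAt I p p)

/-- The Christoffel symbols `Γ(v, w) = v^i w^j Γ^k_{ij} ∂_k` of the Levi-Civita connection at `p`, in
the chart around `p`; they are given by
`g(Γ(v, w), z) = ((∂_v g)(w, z) + (∂_w g)(v, z) - (∂_z g)(v, w)) / 2`. -/
def christoffel (g : RiemMetric I N) (p : N) :
    TangentSpace I p →ₗ[ℝ] TangentSpace I p →ₗ[ℝ] TangentSpace I p :=
  (LinearMap.mk₂ ℝ
    (fun v w : E => sharp g p (((1 / 2 : ℝ) • (chartMetricDeriv g p v w + chartMetricDeriv g p w v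
      - ((chartMetricDeriv g p).flip v).flip w)).comp (chartCoord I p p)).toLinearMap)
    (fun v v' w => by
      rw [← map_add]; congr 1; ext z; simp; ring)
    (fun c v w => by
      rw [← map_smul]; congr 1; ext z; simp; ring)
    (fun v w w' => by
      rw [← map_add]; congr 1; ext z; simp; ring)
    (fun c v w => by
      rw [← map_smul]; congr 1; ext z; simp; ring)).compl₁₂
    (chartCoord I p p).toLinearMap (chartCoord I p p).toLinearMap

theorem chartMetricDeriv_symm (g : RiemMetric I N) (p : N) (a b c : E) :
    chartMetricDeriv g p a b c = chartMetricDeriv g p a c b := by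
  by_cases hd : DifferentiableAt ℝ (chartMetric g p) (extChartAt I p p)
  · have h1 : ∀ u v : E, fderiv ℝ (fun y => chartMetric g p y u v) (extChartAt I p p) a =
        chartMetricDeriv g p a u v := by
      intro u v
      have h2 := (hd.hasFDerivAt.clm_apply (hasFDerivAt_const u _)).clm_apply (hasFDerivAt_const v _)
      rw [h2.fderiv]
      simp [chartMetricDeriv]
    have h3 : (fun y => chartMetric g p y b c) = fun y => chartMetric g p y c b :=
      funext fun y => g.symm _ _ _
    rw [← h1, ← h1, h3]
  · unfold chartMetricDeriv
    rw [fderiv_zero_of_not_differentiableAt hd]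
    rfl

theorem inner_christoffel (g : RiemMetric I N) (p : N) (v w z : TangentSpace I p) :
    g.inner p (christoffel g p v w) z = (1 / 2 : ℝ) *
      (chartMetricDeriv g p (chartCoord I p p v) (chartCoord I p p w) (chartCoord I p p z)
      + chartMetricDeriv g p (chartCoord I p p w) (chartCoord I p p v) (chartCoord I p p z)
      - chartMetricDeriv g p (chartCoord I p p z) (chartCoord I p p v) (chartCoord I p p w)) :=
  inner_sharp g p _ z

/-- The connection is torsion-free. -/
theorem christoffel_symm (g : RiemMetric I N) (p : N) (v w : TangentSpace I p) :
    christoffel g p v w = christoffel g p w v := by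
  apply (flat g p).injective
  ext z
  have e : ∀ u : TangentSpace I p, flat g p u z = g.inner p u z := fun _ => rfl
  rw [e, e, inner_christoffel, inner_christoffel,
    chartMetricDeriv_symm g p _ (chartCoord I p p w) (chartCoord I p p v)]
  ring

/-- The connection is compatible with the metric. -/
theorem christoffel_metric (g : RiemMetric I N) (p : N) (v w z : TangentSpace I p) :
    chartMetricDeriv g p (chartCoord I p p v) (chartCoord I p p w) (chartCoord I p p z) =
      g.inner p (christoffel g p v w) z + g.inner p w (christoffel g p v z) := by
  rw [g.symm p w, inner_christoffel, inner_christoffel,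
    chartMetricDeriv_symm g p (chartCoord I p p v) (chartCoord I p p z),
    chartMetricDeriv_symm g p (chartCoord I p p z) (chartCoord I p p v)]
  ring

/-- The Levi-Civita covariant derivative `∇_v V` at `p`, in the direction `v ∈ T_p N`, of a vector
field `V` along the map `φ : N → M`; in coordinates `v(V^a) ∂_a + Γ(dφ(v), V)`. -/
def covDerivAlong (k : RiemMetric J M) (φ : N → M) (V : ∀ q : N, TangentSpace J (φ q)) (p : N)
    (v : TangentSpace I p) : TangentSpace J (φ p) :=
  frameAt J (φ p) (mfderiv I 𝓘(ℝ, F) (fun q => chartCoord J (φ p) (φ q) (V q)) p v) +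
    christoffel k (φ p) (mfderiv I J φ p v) (V p)

/-- The second fundamental form `h` of an isometric immersion `φ`, defined by the Gauss formula
`∇̃_v (dφ(Y)) = dφ(∇_v Y) + h(v, Y)`; in coordinates
`h(v, w)^a = v^i w^j (∂_i ∂_j φ^a + Γ̃^a_{bc} ∂_i φ^b ∂_j φ^c - Γ^k_{ij} ∂_k φ^a)`.
See `gauss_formula` for the first expression. -/
def secondFundamentalForm (g : RiemMetric I N) (k : RiemMetric J M) (φ : N → M) (p : N) :
    TangentSpace I p →ₗ[ℝ] TangentSpace I p →ₗ[ℝ] TangentSpace J (φ p) :=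
  LinearMap.mk₂ ℝ
    (fun v w =>
      frameAt J (φ p) (fderiv ℝ (fderiv ℝ (writtenInExtChartAt I J p φ)) (extChartAt I p p) 
        (chartCoord I p p v) (chartCoord I p p w))
      + christoffel k (φ p) (mfderiv I J φ p v) (mfderiv I J φ p w)
      - mfderiv I J φ p (christoffel g p v w))
    (fun v v' w => by simp; abel)
    (fun c v w => by simp [smul_sub])
    (fun v w w' => by simp; abel)
    (fun c v w => by simp [smul_sub])


/-- The Levi-Civita covariant derivative `∇_v Y` of a vector field `Y` on `N`. -/
def covDeriv (g : RiemMetric I N) (Y : ∀ q : N, TangentSpace I q) (p : N) (v : TangentSpace I p) :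
    TangentSpace I p :=
  covDerivAlong g id Y p (v : TangentSpace I p)

theorem chartCoord_self (p : N) : chartCoord I p p = ContinuousLinearMap.id ℝ E := by
  unfold chartCoord
  rw [← TangentBundle.continuousLinearMapAt_trivializationAt (mem_chart_source H p)]
  rw [TangentBundle.continuousLinearMapAt_trivializationAt_eq_core (mem_chart_source H p)]
  ext v
  exact (tangentBundleCore I N).coordChange_self _ _ (mem_chart_source H p) v

theorem frameAt_self [I.Boundaryless] (p : N) : frameAt I p = ContinuousLinearMap.id ℝ E := by
  unfold frameAt chartFrame
  have h := TangentBundle.symmL_trivializationAt (I := I) (mem_chart_source H p)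
  rw [TangentBundle.symmL_trivializationAt_eq_core (mem_chart_source H p)] at h
  rw [I.range_eq_univ, mfderivWithin_univ] at h
  refine h.symm.trans ?_
  ext v
  exact (tangentBundleCore I N).coordChange_self _ _ (mem_chart_source H p) v


theorem fderiv_written [I.Boundaryless] [J.Boundaryless] {φ : N → M} (hφ : ContMDiff I J ∞ φ)
    (p : N) : ∀ᶠ q in nhds p, ∀ v : TangentSpace I q,
      chartCoord J (φ p) (φ q) (mfderiv I J φ q v) =
        fderiv ℝ (writtenInExtChartAt I J p φ) (extChartAt I p q) (chartCoord I p q v) := by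
  have h1 := extChartAt_source_mem_nhds (I := I) p
  have h2 := hφ.continuous.continuousAt.preimage_mem_nhds
    (extChartAt_source_mem_nhds (I := J) (φ p))
  filter_upwards [eventually_mem_nhds_iff.2 h1, eventually_mem_nhds_iff.2 h2] with q hq1 hq2 v
  have hs : q ∈ (chartAt H p).source := by simpa using mem_of_mem_nhds hq1
  have hs' : φ q ∈ (chartAt K (φ p)).source := by simpa using mem_of_mem_nhds hq2
  have d1 : MDifferentiableAt I 𝓘(ℝ, E) (extChartAt I p) q := mdifferentiableAt_extChartAt hs
  have d2 : MDifferentiableAt J 𝓘(ℝ, F) (extChartAt J (φ p)) (φ q) :=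
    mdifferentiableAt_extChartAt hs'
  have d3 : MDifferentiableAt I J φ q := hφ.mdifferentiableAt (by simp)
  have d4 : MDifferentiableAt 𝓘(ℝ, E) I (extChartAt I p).symm (extChartAt I p q) := by
    have := mdifferentiableWithinAt_extChartAt_symm (I := I)
      ((extChartAt I p).map_source (mem_of_mem_nhds hq1))
    rwa [I.range_eq_univ, mdifferentiableWithinAt_univ] at this
  have e1 : (extChartAt I p).symm (extChartAt I p q) = q :=
    (extChartAt I p).left_inv (mem_of_mem_nhds hq1)
  have d5 : MDifferentiableAt 𝓘(ℝ, E) 𝓘(ℝ, F) (writtenInExtChartAt I J p φ)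
      (extChartAt I p q) := by
    have d3' : MDifferentiableAt I J φ ((extChartAt I p).symm (extChartAt I p q)) := by rwa [e1]
    have d2' : MDifferentiableAt J 𝓘(ℝ, F) (extChartAt J (φ p))
      (φ ((extChartAt I p).symm (extChartAt I p q))) := by rwa [e1]
    exact d2'.comp (extChartAt I p q) (MDifferentiableAt.comp (extChartAt I p q) d3' d4)
  have e2 : (fun x => extChartAt J (φ p) (φ x)) =ᶠ[nhds q]
      (fun x => writtenInExtChartAt I J p φ (extChartAt I p x)) := by
    filter_upwards [hq1] with x hx
    simp only [writtenInExtChartAt, Function.comp_apply]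
    rw [(extChartAt I p).left_inv hx]
  have e3 := mfderiv_comp q d2 d3
  have e4 := mfderiv_comp q d5 d1
  have e5 := e2.mfderiv_eq (I := I) (I' := 𝓘(ℝ, F))
  rw [← mfderiv_eq_fderiv]
  have := congrArg (fun L => L v) (e3.symm.trans (e5.trans e4))
  exact this

/-- The Gauss formula for an arbitrary differentiable vector field `Y`. -/
theorem gauss_formula [I.Boundaryless] [J.Boundaryless] (g : RiemMetric I N) (k : RiemMetric J M)
    {φ : N → M} (hφ : ContMDiff I J ∞ φ) (Y : ∀ q : N, TangentSpace I q) (p : N)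
    (hY : MDifferentiableAt I I.tangent (fun q => (⟨q, Y q⟩ : TangentBundle I N)) p)
    (v : TangentSpace I p) :
    covDerivAlong k φ (fun q => mfderiv I J φ q (Y q)) p v =
      mfderiv I J φ p (covDeriv g Y p v) + secondFundamentalForm g k φ p v (Y p) := by
  have hw : ContDiffAt ℝ ∞ (writtenInExtChartAt I J p φ) (extChartAt I p p) := by
    have h := (contMDiffAt_iff.1 (hφ p)).2
    rwa [I.range_eq_univ, contDiffWithinAt_univ] at h
  have hdw : DifferentiableAt ℝ (fderiv ℝ (writtenInExtChartAt I J p φ)) (extChartAt I p p) :=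
    (hw.fderiv_right (m := 1) (by norm_cast)).differentiableAt (by simp)
  set y : N → E := fun q => chartCoord I p q (Y q) with hy
  have hyd : MDifferentiableAt I 𝓘(ℝ, E) y p := by
    have h := (mdifferentiableAt_section I Y).1 hY
    refine h.congr_of_eventuallyEq ?_
    filter_upwards [(chartAt H p).open_source.mem_nhds (mem_chart_source H p)] with q hq
    simp only [hy]
    unfold chartCoord
    rw [← TangentBundle.continuousLinearMapAt_trivializationAt hq]
    rw [Trivialization.continuousLinearMapAt_apply, Trivialization.linearMapAt_apply, if_pos]
    simpa using hq
  have hcd : MDifferentiableAt I 𝓘(ℝ, E) (extChartAt I p) p :=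
    mdifferentiableAt_extChartAt (mem_chart_source H p)
  have hB : HasFDerivAt (fun z : E × E => fderiv ℝ (writtenInExtChartAt I J p φ) z.1 z.2)
      ((fderiv ℝ (writtenInExtChartAt I J p φ) (extChartAt I p p)).comp
        (ContinuousLinearMap.snd ℝ E E) +
        ((fderiv ℝ (fderiv ℝ (writtenInExtChartAt I J p φ)) (extChartAt I p p)).comp
          (ContinuousLinearMap.fst ℝ E E)).flip (y p)) (extChartAt I p p, y p) :=
    HasFDerivAt.clm_apply (c := fun z : E × E => fderiv ℝ (writtenInExtChartAt I J p φ) z.1)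
      (u := fun z : E × E => z.2) (x := (extChartAt I p p, y p))
      (HasFDerivAt.comp (g := fderiv ℝ (writtenInExtChartAt I J p φ))
        (extChartAt I p p, y p) hdw.hasFDerivAt hasFDerivAt_fst) hasFDerivAt_snd
  have hcy : HasMFDerivAt I 𝓘(ℝ, E × E) (fun q => (extChartAt I p q, y q)) p
      ((chartCoord I p p).prod (mfderiv I 𝓘(ℝ, E) y p)) :=
    ⟨hcd.hasMFDerivAt.1.prodMk hyd.hasMFDerivAt.1, hcd.hasMFDerivAt.2.prodMk hyd.hasMFDerivAt.2⟩
  have hW := HasMFDerivAt.comp p hB.hasMFDerivAt hcy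
  have hev : (fun q => chartCoord J (φ p) (φ q) (mfderiv I J φ q (Y q))) =ᶠ[nhds p]
      (fun q => fderiv ℝ (writtenInExtChartAt I J p φ) (extChartAt I p q) (y q)) := by
    filter_upwards [fderiv_written hφ p] with q hq
    exact hq _
  have hd := (hW.congr_of_eventuallyEq hev).mfderiv
  have hyp : y p = chartCoord I p p (Y p) := rfl
  have hd' : mfderiv I 𝓘(ℝ, F) (fun q => chartCoord J (φ p) (φ q) (mfderiv I J φ q (Y q))) p v =
      fderiv ℝ (writtenInExtChartAt I J p φ) (extChartAt I p p) (mfderiv I 𝓘(ℝ, E) y p v) +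
      fderiv ℝ (fderiv ℝ (writtenInExtChartAt I J p φ)) (extChartAt I p p) (chartCoord I p p v) (y p) :=
    congrArg (fun L => L v) hd
  have hφd : ∀ u : TangentSpace I p, mfderiv I J φ p u =
      frameAt J (φ p) (fderiv ℝ (writtenInExtChartAt I J p φ) (extChartAt I p p) u) := by
    intro u
    have h := (fderiv_written hφ p).self_of_nhds u
    rw [chartCoord_self, chartCoord_self] at h
    rw [frameAt_self]
    exact h
  have hL : covDerivAlong k φ (fun q => mfderiv I J φ q (Y q)) p v =
      frameAt J (φ p) (mfderiv I 𝓘(ℝ, F)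
        (fun q => chartCoord J (φ p) (φ q) (mfderiv I J φ q (Y q))) p v) +
      christoffel k (φ p) (mfderiv I J φ p v) (mfderiv I J φ p (Y p)) := rfl
  have hR : covDeriv g Y p v = frameAt I p (mfderiv I 𝓘(ℝ, E) y p v) +
      christoffel g p v (Y p) := by
    have h1 : covDeriv g Y p v = frameAt I p (mfderiv I 𝓘(ℝ, E) y p v) +
      christoffel g p (mfderiv I I id p v) (Y p) := rfl
    rw [h1, mfderiv_id]; rfl
  have hS : secondFundamentalForm g k φ p v (Y p) =
      frameAt J (φ p) (fderiv ℝ (fderiv ℝ (writtenInExtChartAt I J p φ)) (extChartAt I p p)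
        (chartCoord I p p v) (y p))
      + christoffel k (φ p) (mfderiv I J φ p v) (mfderiv I J φ p (Y p))
      - mfderiv I J φ p (christoffel g p v (Y p)) := rfl
  have hfr : mfderiv I J φ p (frameAt I p (mfderiv I 𝓘(ℝ, E) y p v)) =
      frameAt J (φ p) (fderiv ℝ (writtenInExtChartAt I J p φ) (extChartAt I p p)
        (mfderiv I 𝓘(ℝ, E) y p v)) := by
    rw [hφd, frameAt_self p]; rfl
  rw [hL, hR, hS, hd', map_add, map_add, hfr]
  abel

end LeviCivita

section Immersion

variable {E : Type*} [NormedAddCommGroup E] [NormedSpace ℝ E] [FiniteDimensional ℝ E]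
  {H : Type*} [TopologicalSpace H] {I : ModelWithCorners ℝ E H}
  {N : Type*} [TopologicalSpace N] [ChartedSpace H N] [IsManifold I ∞ N]
  {F : Type*} [NormedAddCommGroup F] [NormedSpace ℝ F] [FiniteDimensional ℝ F]
  {K : Type*} [TopologicalSpace K] {J : ModelWithCorners ℝ F K}
  {M : Type*} [TopologicalSpace M] [ChartedSpace K M] [IsManifold J ∞ M]

/-- `φ : (N, g) → (M, k)` is a smooth isometric immersion. -/
structure IsIsometricImmersion (g : RiemMetric I N) (k : RiemMetric J M) (φ : N → M) : Prop where
  contMDiff : ContMDiff I J ∞ φ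
  injective : ∀ p, Function.Injective (mfderiv I J φ p)
  isometric : ∀ (p : N) (v w : TangentSpace I p),
    k.inner (φ p) (mfderiv I J φ p v) (mfderiv I J φ p w) = g.inner p v w

/-- The component of `u ∈ T_{φ(p)} M` normal to the immersion `φ` at `p`: `u` minus the vector
`dφ(t)`, where `t ∈ T_p N` is given by `g(t, w) = k(u, dφ(w))`. -/
def normalComponent (g : RiemMetric I N) (k : RiemMetric J M) (φ : N → M) (p : N)
    (u : TangentSpace J (φ p)) : TangentSpace J (φ p) :=
  u - mfderiv I J φ p (sharp g p ((k.inner (φ p) u).comp (mfderiv I J φ p)).toLinearMap)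

/-- `D f`, the normal component along `φ` of the gradient of `f : M → ℝ`. -/
def normalGradient (g : RiemMetric I N) (k : RiemMetric J M) (φ : N → M) (f : M → ℝ) (p : N) :
    TangentSpace J (φ p) :=
  normalComponent g k φ p (gradient k f (φ p))

/-- The shape operator `A_ζ` at `p` for a vector `ζ` normal to `φ` at `p`, given by
`g(A_ζ v, w) = k(h(v, w), ζ)`. -/
def shapeOperator (g : RiemMetric I N) (k : RiemMetric J M) (φ : N → M) (p : N)
    (ζ : TangentSpace J (φ p)) : TangentSpace I p →ₗ[ℝ] TangentSpace I p :=
  (sharp g p).toLinearMap ∘ₗ (secondFundamentalForm g k φ p).compr₂ (k.inner (φ p) ζ).toLinearMap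

theorem inner_shapeOperator (g : RiemMetric I N) (k : RiemMetric J M) (φ : N → M) (p : N)
    (ζ : TangentSpace J (φ p)) (v w : TangentSpace I p) :
    g.inner p (shapeOperator g k φ p ζ v) w =
      k.inner (φ p) (secondFundamentalForm g k φ p v w) ζ := by
  rw [k.symm]
  exact inner_sharp _ _ _ _

/-- The mean curvature vector `(1/n) trace h`. The trace is the contraction `∑ h(b_i, b^i)` of a
basis with its `g`-dual basis, i.e. `∑ h(e_i, e_i)` for any orthonormal basis. -/
def meanCurvature (g : RiemMetric I N) (k : RiemMetric J M) (φ : N → M) (p : N) : TangentSpace J (φ p) :=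
  (Module.finrank ℝ E : ℝ)⁻¹ • ∑ i, secondFundamentalForm g k φ p
    (Module.finBasis ℝ (TangentSpace I p) i)
    (sharp g p ((Module.finBasis ℝ (TangentSpace I p)).coord i))

theorem meanCurvature_eq_sum_orthonormal (g : RiemMetric I N) (k : RiemMetric J M) (φ : N → M) (p : N)
    {ι : Type*} [Fintype ι] [DecidableEq ι] (e : Module.Basis ι ℝ (TangentSpace I p))
    (he : ∀ i j, g.inner p (e i) (e j) = if i = j then 1 else 0) :
    meanCurvature g k φ p =
      (Module.finrank ℝ E : ℝ)⁻¹ • ∑ i, secondFundamentalForm g k φ p (e i) (e i) := by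
  have hs : ∀ α : Module.Dual ℝ (TangentSpace I p), sharp g p α = ∑ i, α (e i) • e i := by
    intro α
    rw [← (sharp g p).symm.injective.eq_iff, LinearEquiv.symm_apply_apply]
    refine e.ext fun j => ?_
    have : (sharp g p).symm (∑ i, α (e i) • e i) (e j) = g.inner p (∑ i, α (e i) • e i) (e j) := rfl
    rw [this]
    simp [he]
  unfold meanCurvature
  congr 1
  set b := Module.finBasis ℝ (TangentSpace I p) with hb
  simp only [hs, map_sum, map_smul]
  rw [Finset.sum_comm]
  refine Finset.sum_congr rfl fun i _ => ?_
  have h := congrArg (fun x => secondFundamentalForm g k φ p x (e i)) (b.sum_repr (e i))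
  simp only [map_sum, map_smul, LinearMap.sum_apply, LinearMap.smul_apply] at h
  exact h

/-- `η` is, on the open set `U`, a smooth vector field along `φ` normal to `φ`. -/
structure IsNormalField (k : RiemMetric J M) (φ : N → M) (U : Set N)
    (η : ∀ q : N, TangentSpace J (φ q)) : Prop where
  contMDiffOn : ContMDiffOn I J.tangent ∞ (fun q => (⟨φ q, η q⟩ : TangentBundle J M)) U
  normal : ∀ q ∈ U, ∀ v : TangentSpace I q, k.inner (φ q) (η q) (mfderiv I J φ q v) = 0

/-- `φ` is umbilical on `U` with respect to `η`: `A_η = c · id` for a smooth function `c`. -/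
def IsUmbilicalWith (g : RiemMetric I N) (k : RiemMetric J M) (φ : N → M) (U : Set N)
    (η : ∀ q : N, TangentSpace J (φ q)) : Prop :=
  ∃ c : N → ℝ, ContMDiffOn I 𝓘(ℝ, ℝ) ∞ c U ∧
    ∀ q ∈ U, shapeOperator g k φ q (η q) = c q • LinearMap.id

/-- `φ` is umbilical with respect to every local normal vector field. -/
def IsTotallyUmbilical (g : RiemMetric I N) (k : RiemMetric J M) (φ : N → M) : Prop :=
  ∀ (U : Set N) (η : ∀ q : N, TangentSpace J (φ q)), IsOpen U →
    IsNormalField (I := I) k φ U η → IsUmbilicalWith g k φ U η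

end Immersion

section ProductImmersion

variable {E₁ : Type*} [NormedAddCommGroup E₁] [NormedSpace ℝ E₁] [FiniteDimensional ℝ E₁]
  {H₁ : Type*} [TopologicalSpace H₁] {I₁ : ModelWithCorners ℝ E₁ H₁}
  {N₁ : Type*} [TopologicalSpace N₁] [ChartedSpace H₁ N₁] [IsManifold I₁ ∞ N₁]
  {E₂ : Type*} [NormedAddCommGroup E₂] [NormedSpace ℝ E₂] [FiniteDimensional ℝ E₂]
  {H₂ : Type*} [TopologicalSpace H₂] {I₂ : ModelWithCorners ℝ E₂ H₂}
  {N₂ : Type*} [TopologicalSpace N₂] [ChartedSpace H₂ N₂] [IsManifold I₂ ∞ N₂]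
  {F₁ : Type*} [NormedAddCommGroup F₁] [NormedSpace ℝ F₁] [FiniteDimensional ℝ F₁]
  {K₁ : Type*} [TopologicalSpace K₁] {J₁ : ModelWithCorners ℝ F₁ K₁}
  {M₁ : Type*} [TopologicalSpace M₁] [ChartedSpace K₁ M₁] [IsManifold J₁ ∞ M₁]
  {F₂ : Type*} [NormedAddCommGroup F₂] [NormedSpace ℝ F₂] [FiniteDimensional ℝ F₂]
  {K₂ : Type*} [TopologicalSpace K₂] {J₂ : ModelWithCorners ℝ F₂ K₂}
  {M₂ : Type*} [TopologicalSpace M₂] [ChartedSpace K₂ M₂] [IsManifold J₂ ∞ M₂]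

theorem doublyWarped_apply (g₁ : RiemMetric I₁ N₁) (g₂ : RiemMetric I₂ N₂)
    (f₁ : WarpingFunction I₁ N₁) (f₂ : WarpingFunction I₂ N₂) (p : N₁ × N₂)
    (v w : TangentSpace (I₁.prod I₂) p) :
    (doublyWarped g₁ g₂ f₁ f₂).inner p v w =
      (f₂.toFun p.2) ^ 2 * g₁.inner p.1 v.1 w.1 + (f₁.toFun p.1) ^ 2 * g₂.inner p.2 v.2 w.2 := by
  have h : (doublyWarped g₁ g₂ f₁ f₂).inner p =
    (f₂.toFun p.2) ^ 2 • pullback (I := I₁.prod I₂) g₁ Prod.fst p +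
    (f₁.toFun p.1) ^ 2 • pullback (I := I₁.prod I₂) g₂ Prod.snd p := rfl
  simp only [h, add_apply, smul_apply, pullback_apply, mfderiv_fst, mfderiv_snd, smul_eq_mul]
  rfl

/-- A doubly warped product immersion is an isometric immersion. -/
theorem IsIsometricImmersion.prodMap {g₁ : RiemMetric I₁ N₁} {g₂ : RiemMetric I₂ N₂}
    {k₁ : RiemMetric J₁ M₁} {k₂ : RiemMetric J₂ M₂} {φ₁ : N₁ → M₁} {φ₂ : N₂ → M₂}
    (h₁ : IsIsometricImmersion g₁ k₁ φ₁) (h₂ : IsIsometricImmersion g₂ k₂ φ₂)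
    (ρ₁ : WarpingFunction J₁ M₁) (ρ₂ : WarpingFunction J₂ M₂) :
    IsIsometricImmersion
      (doublyWarped g₁ g₂ (ρ₁.comp φ₁ h₁.contMDiff) (ρ₂.comp φ₂ h₂.contMDiff))
      (doublyWarped k₁ k₂ ρ₁ ρ₂) (Prod.map φ₁ φ₂) := by
  have hd : ∀ p : N₁ × N₂, mfderiv (I₁.prod I₂) (J₁.prod J₂) (Prod.map φ₁ φ₂) p =
      (mfderiv I₁ J₁ φ₁ p.1).prodMap (mfderiv I₂ J₂ φ₂ p.2) := fun p =>
    mfderiv_prodMap (h₁.contMDiff.mdifferentiableAt (by simp))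
      (h₂.contMDiff.mdifferentiableAt (by simp))
  refine ⟨h₁.contMDiff.prodMap h₂.contMDiff, fun p => ?_, fun p v w => ?_⟩
  · rw [hd]
    exact (h₁.injective p.1).prodMap (h₂.injective p.2)
  · rw [doublyWarped_apply, doublyWarped_apply, hd]
    exact congrArg₂ (fun a b : ℝ => (ρ₂.toFun (φ₂ p.2)) ^ 2 * a + (ρ₁.toFun (φ₁ p.1)) ^ 2 * b)
      (h₁.isometric p.1 v.1 w.1) (h₂.isometric p.2 v.2 w.2)

end ProductImmersion

end DoublyWarped

end

open DoublyWarped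

namespace DoublyWarped

section Chart

variable {E : Type*} [NormedAddCommGroup E] [NormedSpace ℝ E] [FiniteDimensional ℝ E]
  {H : Type*} [TopologicalSpace H] {I : ModelWithCorners ℝ E H} [I.Boundaryless]
  {N : Type*} [TopologicalSpace N] [ChartedSpace H N] [IsManifold I ∞ N]

theorem metric_ext (g : RiemMetric I N) (p : N) {v w : TangentSpace I p}
    (h : ∀ z, g.inner p v z = g.inner p w z) : v = w := by
  apply (flat g p).injective
  ext z
  exact h z

theorem chartMetric_apply (g : RiemMetric I N) (p : N) (y b c : E) :
    chartMetric g p y b c =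
      g.inner ((extChartAt I p).symm y) (chartFrame I p y b) (chartFrame I p y c) := rfl

theorem extChartAt_target_mem_nhds_self (p : N) :
    (extChartAt I p).target ∈ nhds (extChartAt I p p) := by
  have := extChartAt_target_mem_nhdsWithin (I := I) p
  rwa [I.range_eq_univ, nhdsWithin_univ] at this

theorem mdifferentiableAt_extChartAt_symm_of_mem (p : N) {y : E}
    (hy : y ∈ (extChartAt I p).target) :
    MDifferentiableAt 𝓘(ℝ, E) I (extChartAt I p).symm y := by
  have := mdifferentiableWithinAt_extChartAt_symm (I := I) hy
  rwa [I.range_eq_univ, mdifferentiableWithinAt_univ] at this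

theorem contMDiffAt_extChartAt_symm_self (p : N) :
    ContMDiffAt 𝓘(ℝ, E) I ∞ (extChartAt I p).symm (extChartAt I p p) :=
  (contMDiffOn_extChartAt_symm p).contMDiffAt (extChartAt_target_mem_nhds_self p)

theorem differentiableAt_chartMetric (g : RiemMetric I N) (p : N) :
    DifferentiableAt ℝ (chartMetric g p) (extChartAt I p p) := by
  obtain ⟨C, hC, hCe⟩ := contMDiff_metric_coord g p
  have hs := contMDiffAt_extChartAt_symm_self (I := I) p
  have e1 : (extChartAt I p).symm (extChartAt I p p) = p := extChartAt_to_inv p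
  have hC' : ContMDiffAt 𝓘(ℝ, E) 𝓘(ℝ, E →L[ℝ] E →L[ℝ] ℝ) ∞
      (fun y => C ((extChartAt I p).symm y)) (extChartAt I p p) :=
    ContMDiffAt.comp (extChartAt I p p) (by rwa [e1]) hs
  refine (hC'.contDiffAt.differentiableAt (by simp)).congr_of_eventuallyEq ?_
  have hc : Filter.Tendsto (extChartAt I p).symm (nhds (extChartAt I p p)) (nhds p) := by
    have := hs.continuousAt.tendsto
    rwa [e1] at this
  filter_upwards [hc.eventually hCe, extChartAt_target_mem_nhds_self (I := I) p] with y hy hyt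
  ext b c
  rw [hy, chartMetric_apply]
  have hsrc : (extChartAt I p).symm y ∈ (chartAt H p).source := by
    simpa using (extChartAt I p).map_target hyt
  have key : ∀ u : E, (trivializationAt E (TangentSpace I) p).symm ((extChartAt I p).symm y) u =
      chartFrame I p y u := by
    intro u
    rw [← (trivializationAt E (TangentSpace I) p).symmL_apply (R := ℝ) (by simpa using hsrc),
      TangentBundle.symmL_trivializationAt hsrc, I.range_eq_univ, mfderivWithin_univ,
      (extChartAt I p).right_inv hyt]
    rfl
  rw [key, key]

theorem chartMetricDeriv_apply (g : RiemMetric I N) (p : N) (a b c : E) :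
    chartMetricDeriv g p a b c =
      fderiv ℝ (fun y => chartMetric g p y b c) (extChartAt I p p) a := by
  have h := ((differentiableAt_chartMetric g p).hasFDerivAt.clm_apply
    (hasFDerivAt_const b _)).clm_apply (hasFDerivAt_const c _)
  rw [h.fderiv]
  simp [chartMetricDeriv]

theorem differentiableAt_chartMetric_apply (g : RiemMetric I N) (p : N) (b c : E) :
    DifferentiableAt ℝ (fun y => chartMetric g p y b c) (extChartAt I p p) :=
  ((differentiableAt_chartMetric g p).clm_apply (differentiableAt_const b)).clm_apply
    (differentiableAt_const c)

theorem chartMetric_self (g : RiemMetric I N) (p : N) (b c : TangentSpace I p) :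
    chartMetric g p (extChartAt I p p) b c = g.inner p b c := by
  have e1 : (extChartAt I p).symm (extChartAt I p p) = p := extChartAt_to_inv p
  have h : ∀ q (e : q = p) (L : E →L[ℝ] TangentSpace I q),
      (∀ u : E, (L u : E) = u) → g.inner q (L b) (L c) = g.inner p b c := by
    rintro q rfl L hL
    have hb : L b = b := hL b
    have hc : L c = c := hL c
    rw [hb, hc]
  refine h _ e1 (chartFrame I p (extChartAt I p p)) fun u => ?_
  have := congrArg (fun L : E →L[ℝ] E => L u) (frameAt_self (I := I) p)
  exact this

theorem WarpingFunction.differentiableAt_chart (f : WarpingFunction I N) (p : N) :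
    DifferentiableAt ℝ (fun y => f.toFun ((extChartAt I p).symm y)) (extChartAt I p p) :=
  ((ContMDiffAt.comp (extChartAt I p p) (f.contMDiff _)
    (contMDiffAt_extChartAt_symm_self (I := I) p)).contDiffAt).differentiableAt (by simp)

theorem WarpingFunction.mdifferentiableAt (f : WarpingFunction I N) (p : N) :
    MDifferentiableAt I 𝓘(ℝ, ℝ) f.toFun p := f.contMDiff.mdifferentiableAt (by simp)

/-- The differential of a warping function, as a real linear form. -/
noncomputable def WarpingFunction.diff (f : WarpingFunction I N) (p : N) : TangentSpace I p →L[ℝ] ℝ :=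
  mfderiv I 𝓘(ℝ, ℝ) f.toFun p

theorem WarpingFunction.fderiv_chart (f : WarpingFunction I N) (p : N) (a : TangentSpace I p) :
    fderiv ℝ (fun y => f.toFun ((extChartAt I p).symm y)) (extChartAt I p p) a = f.diff p a := by
  have h : (mfderiv I 𝓘(ℝ, ℝ) f.toFun p : E →L[ℝ] ℝ) =
      fderiv ℝ (fun y => f.toFun ((extChartAt I p).symm y)) (extChartAt I p p) := by
    refine (if_pos (f.mdifferentiableAt p)).trans ?_
    rw [I.range_eq_univ, fderivWithin_univ]
    rfl
  exact congrArg (fun L : E →L[ℝ] ℝ => L a) h.symm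

theorem inner_christoffel_self (g : RiemMetric I N) (p : N) (v w z : TangentSpace I p) :
    g.inner p (christoffel g p v w) z = (1 / 2 : ℝ) * (chartMetricDeriv g p v w z +
      chartMetricDeriv g p w v z - chartMetricDeriv g p z v w) := by
  rw [inner_christoffel, chartCoord_self]
  rfl

end Chart

theorem fderiv_fderiv_prodMap {E₁ E₂ F₁ F₂ : Type*}
    [NormedAddCommGroup E₁] [NormedSpace ℝ E₁] [NormedAddCommGroup E₂] [NormedSpace ℝ E₂]
    [NormedAddCommGroup F₁] [NormedSpace ℝ F₁] [NormedAddCommGroup F₂] [NormedSpace ℝ F₂]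
    {u₁ : E₁ → F₁} {u₂ : E₂ → F₂} {y : E₁ × E₂}
    (h₁ : ContDiffAt ℝ 2 u₁ y.1) (h₂ : ContDiffAt ℝ 2 u₂ y.2) (v w : E₁ × E₂) :
    fderiv ℝ (fderiv ℝ (Prod.map u₁ u₂)) y v w =
      (fderiv ℝ (fderiv ℝ u₁) y.1 v.1 w.1, fderiv ℝ (fderiv ℝ u₂) y.2 v.2 w.2) := by
  have d₁ := (h₁.fderiv_right (m := 1) le_rfl).differentiableAt (by simp)
  have d₂ := (h₂.fderiv_right (m := 1) le_rfl).differentiableAt (by simp)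
  have e : (fun z => fderiv ℝ (Prod.map u₁ u₂) z w) =ᶠ[nhds y]
      fun z => (fderiv ℝ u₁ z.1 w.1, fderiv ℝ u₂ z.2 w.2) := by
    filter_upwards [continuousAt_fst.eventually (h₁.eventually (by simp)),
      continuousAt_snd.eventually (h₂.eventually (by simp))] with z hz₁ hz₂
    rw [((hz₁.differentiableAt (by simp)).hasFDerivAt.prodMap z
      (hz₂.differentiableAt (by simp)).hasFDerivAt).fderiv]
    rfl
  have hd : HasFDerivAt (fun z : E₁ × E₂ => (fderiv ℝ u₁ z.1 w.1, fderiv ℝ u₂ z.2 w.2)) _ y :=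
    (((d₁.hasFDerivAt.comp (f := Prod.fst) y hasFDerivAt_fst).clm_apply
      (hasFDerivAt_const w.1 y)).prodMk
    ((d₂.hasFDerivAt.comp (f := Prod.snd) y hasFDerivAt_snd).clm_apply (hasFDerivAt_const w.2 y)))
  have hdiff : DifferentiableAt ℝ (fderiv ℝ (Prod.map u₁ u₂)) y :=
    ((ContDiffAt.prodMap' h₁ h₂).fderiv_right (m := 1) le_rfl).differentiableAt (by simp)
  have h := hdiff.hasFDerivAt.clm_apply (hasFDerivAt_const w y)
  have h' := congrArg (fun L => L v) (h.unique (hd.congr_of_eventuallyEq e))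
  simpa using h'

section ProductChart

variable {E₁ : Type*} [NormedAddCommGroup E₁] [NormedSpace ℝ E₁] [FiniteDimensional ℝ E₁]
  {H₁ : Type*} [TopologicalSpace H₁] {I₁ : ModelWithCorners ℝ E₁ H₁} [I₁.Boundaryless]
  {N₁ : Type*} [TopologicalSpace N₁] [ChartedSpace H₁ N₁] [IsManifold I₁ ∞ N₁]
  {E₂ : Type*} [NormedAddCommGroup E₂] [NormedSpace ℝ E₂] [FiniteDimensional ℝ E₂]
  {H₂ : Type*} [TopologicalSpace H₂] {I₂ : ModelWithCorners ℝ E₂ H₂} [I₂.Boundaryless]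
  {N₂ : Type*} [TopologicalSpace N₂] [ChartedSpace H₂ N₂] [IsManifold I₂ ∞ N₂]

theorem chartFrame_prod (p : N₁ × N₂) {y : E₁ × E₂}
    (h₁ : y.1 ∈ (extChartAt I₁ p.1).target) (h₂ : y.2 ∈ (extChartAt I₂ p.2).target)
    (b : E₁ × E₂) :
    chartFrame (I₁.prod I₂) p y b = (chartFrame I₁ p.1 y.1 b.1, chartFrame I₂ p.2 y.2 b.2) := by
  have d₁ := (mdifferentiableAt_extChartAt_symm_of_mem p.1 h₁).hasMFDerivAt
  have d₂ := (mdifferentiableAt_extChartAt_symm_of_mem p.2 h₂).hasMFDerivAt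
  have c₁ : HasMFDerivAt 𝓘(ℝ, E₁ × E₂) I₁ (fun z : E₁ × E₂ => (extChartAt I₁ p.1).symm z.1) y _ :=
    HasMFDerivAt.comp (f := Prod.fst) y d₁ (hasFDerivAt_fst (𝕜 := ℝ) (p := y)).hasMFDerivAt
  have c₂ : HasMFDerivAt 𝓘(ℝ, E₁ × E₂) I₂ (fun z : E₁ × E₂ => (extChartAt I₂ p.2).symm z.2) y _ :=
    HasMFDerivAt.comp (f := Prod.snd) y d₂ (hasFDerivAt_snd (𝕜 := ℝ) (p := y)).hasMFDerivAt
  have h := (c₁.prodMk c₂).mfderiv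
  exact congrArg (fun L => L b) h

theorem chartMetric_doublyWarped (g₁ : RiemMetric I₁ N₁) (g₂ : RiemMetric I₂ N₂)
    (f₁ : WarpingFunction I₁ N₁) (f₂ : WarpingFunction I₂ N₂) (p : N₁ × N₂) {y : E₁ × E₂}
    (h₁ : y.1 ∈ (extChartAt I₁ p.1).target) (h₂ : y.2 ∈ (extChartAt I₂ p.2).target)
    (b c : E₁ × E₂) :
    chartMetric (doublyWarped g₁ g₂ f₁ f₂) p y b c =
      f₂.toFun ((extChartAt I₂ p.2).symm y.2) ^ 2 * chartMetric g₁ p.1 y.1 b.1 c.1 +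
      f₁.toFun ((extChartAt I₁ p.1).symm y.1) ^ 2 * chartMetric g₂ p.2 y.2 b.2 c.2 := by
  rw [chartMetric_apply, chartFrame_prod p h₁ h₂, chartFrame_prod p h₁ h₂]
  exact doublyWarped_apply g₁ g₂ f₁ f₂ ((extChartAt I₁ p.1).symm y.1, (extChartAt I₂ p.2).symm y.2)
    (chartFrame I₁ p.1 y.1 b.1, chartFrame I₂ p.2 y.2 b.2)
    (chartFrame I₁ p.1 y.1 c.1, chartFrame I₂ p.2 y.2 c.2)

theorem fderiv_chartMetric_doublyWarped (g₁ : RiemMetric I₁ N₁) (g₂ : RiemMetric I₂ N₂)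
    (f₁ : WarpingFunction I₁ N₁) (f₂ : WarpingFunction I₂ N₂) (p : N₁ × N₂) (a b c : E₁ × E₂) :
    fderiv ℝ (fun y => chartMetric (doublyWarped g₁ g₂ f₁ f₂) p y b c)
        (extChartAt I₁ p.1 p.1, extChartAt I₂ p.2 p.2) a =
      (f₂.toFun p.2 ^ 2 *
          fderiv ℝ (fun y => chartMetric g₁ p.1 y b.1 c.1) (extChartAt I₁ p.1 p.1) a.1 +
        2 * f₂.toFun p.2 *
          fderiv ℝ (fun y => f₂.toFun ((extChartAt I₂ p.2).symm y)) (extChartAt I₂ p.2 p.2) a.2 *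
          chartMetric g₁ p.1 (extChartAt I₁ p.1 p.1) b.1 c.1) +
      (f₁.toFun p.1 ^ 2 *
          fderiv ℝ (fun y => chartMetric g₂ p.2 y b.2 c.2) (extChartAt I₂ p.2 p.2) a.2 +
        2 * f₁.toFun p.1 *
          fderiv ℝ (fun y => f₁.toFun ((extChartAt I₁ p.1).symm y)) (extChartAt I₁ p.1 p.1) a.1 *
          chartMetric g₂ p.2 (extChartAt I₂ p.2 p.2) b.2 c.2) := by
  set y₀ : E₁ × E₂ := (extChartAt I₁ p.1 p.1, extChartAt I₂ p.2 p.2) with hy₀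
  have hev : (fun y => chartMetric (doublyWarped g₁ g₂ f₁ f₂) p y b c) =ᶠ[nhds y₀]
      fun y : E₁ × E₂ =>
        f₂.toFun ((extChartAt I₂ p.2).symm y.2) ^ 2 * chartMetric g₁ p.1 y.1 b.1 c.1 +
        f₁.toFun ((extChartAt I₁ p.1).symm y.1) ^ 2 * chartMetric g₂ p.2 y.2 b.2 c.2 := by
    filter_upwards [continuousAt_fst.preimage_mem_nhds (x := y₀)
        (extChartAt_target_mem_nhds_self (I := I₁) p.1),
      continuousAt_snd.preimage_mem_nhds (x := y₀)
        (extChartAt_target_mem_nhds_self (I := I₂) p.2)] with y h₁ h₂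
    exact chartMetric_doublyWarped g₁ g₂ f₁ f₂ p h₁ h₂ b c
  have m₁ : HasFDerivAt (fun y : E₁ × E₂ => chartMetric g₁ p.1 y.1 b.1 c.1) _ y₀ :=
    (differentiableAt_chartMetric_apply g₁ p.1 b.1 c.1).hasFDerivAt.comp (f := Prod.fst) y₀
      hasFDerivAt_fst
  have m₂ : HasFDerivAt (fun y : E₁ × E₂ => chartMetric g₂ p.2 y.2 b.2 c.2) _ y₀ :=
    (differentiableAt_chartMetric_apply g₂ p.2 b.2 c.2).hasFDerivAt.comp (f := Prod.snd) y₀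
      hasFDerivAt_snd
  have r₁ : HasFDerivAt (fun y : E₁ × E₂ => f₁.toFun ((extChartAt I₁ p.1).symm y.1)) _ y₀ :=
    (f₁.differentiableAt_chart p.1).hasFDerivAt.comp (f := Prod.fst) y₀ hasFDerivAt_fst
  have r₂ : HasFDerivAt (fun y : E₁ × E₂ => f₂.toFun ((extChartAt I₂ p.2).symm y.2)) _ y₀ :=
    (f₂.differentiableAt_chart p.2).hasFDerivAt.comp (f := Prod.snd) y₀ hasFDerivAt_snd
  have hd := hev.fderiv_eq.trans (((r₂.pow 2).mul m₁).add ((r₁.pow 2).mul m₂)).fderiv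
  rw [hd]
  simp [hy₀]
  ring

theorem chartMetricDeriv_doublyWarped (g₁ : RiemMetric I₁ N₁) (g₂ : RiemMetric I₂ N₂)
    (f₁ : WarpingFunction I₁ N₁) (f₂ : WarpingFunction I₂ N₂) (p : N₁ × N₂)
    (a b c : TangentSpace (I₁.prod I₂) p) :
    chartMetricDeriv (doublyWarped g₁ g₂ f₁ f₂) p a b c =
      (f₂.toFun p.2 ^ 2 * chartMetricDeriv g₁ p.1 a.1 b.1 c.1 +
        2 * f₂.toFun p.2 * f₂.diff p.2 a.2 * g₁.inner p.1 b.1 c.1) +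
      (f₁.toFun p.1 ^ 2 * chartMetricDeriv g₂ p.2 a.2 b.2 c.2 +
        2 * f₁.toFun p.1 * f₁.diff p.1 a.1 * g₂.inner p.2 b.2 c.2) := by
  refine (chartMetricDeriv_apply (doublyWarped g₁ g₂ f₁ f₂) p a b c).trans ?_
  have s₁ := chartMetric_self g₁ p.1 b.1 c.1
  have s₂ := chartMetric_self g₂ p.2 b.2 c.2
  have u₁ := f₁.fderiv_chart p.1 a.1
  have u₂ := f₂.fderiv_chart p.2 a.2
  have w₁ := chartMetricDeriv_apply g₁ p.1 a.1 b.1 c.1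
  have w₂ := chartMetricDeriv_apply g₂ p.2 a.2 b.2 c.2
  rw [w₁, w₂, ← u₁, ← u₂, ← s₁, ← s₂]
  exact fderiv_chartMetric_doublyWarped g₁ g₂ f₁ f₂ p a b c

theorem inner_christoffel_doublyWarped (g₁ : RiemMetric I₁ N₁) (g₂ : RiemMetric I₂ N₂)
    (f₁ : WarpingFunction I₁ N₁) (f₂ : WarpingFunction I₂ N₂) (p : N₁ × N₂)
    (v w z : TangentSpace (I₁.prod I₂) p) :
    (doublyWarped g₁ g₂ f₁ f₂).inner p (christoffel (doublyWarped g₁ g₂ f₁ f₂) p v w) z =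
      f₂.toFun p.2 ^ 2 * g₁.inner p.1 (christoffel g₁ p.1 v.1 w.1) z.1 +
      f₁.toFun p.1 ^ 2 * g₂.inner p.2 (christoffel g₂ p.2 v.2 w.2) z.2 +
      f₂.toFun p.2 * (f₂.diff p.2 v.2 * g₁.inner p.1 w.1 z.1 +
        f₂.diff p.2 w.2 * g₁.inner p.1 v.1 z.1 - f₂.diff p.2 z.2 * g₁.inner p.1 v.1 w.1) +
      f₁.toFun p.1 * (f₁.diff p.1 v.1 * g₂.inner p.2 w.2 z.2 +
        f₁.diff p.1 w.1 * g₂.inner p.2 v.2 z.2 - f₁.diff p.1 z.1 * g₂.inner p.2 v.2 w.2) := by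
  have h := chartMetricDeriv_doublyWarped g₁ g₂ f₁ f₂ p
  have h₁ := inner_christoffel_self g₁ p.1 v.1 w.1 z.1
  have h₂ := inner_christoffel_self g₂ p.2 v.2 w.2 z.2
  refine (inner_christoffel_self (doublyWarped g₁ g₂ f₁ f₂) p v w z).trans ?_
  refine (congrArg₂ (fun s t : ℝ => (1 / 2 : ℝ) * (s - t))
    (congrArg₂ (fun s t : ℝ => s + t) (h v w z) (h w v z)) (h z v w)).trans ?_
  rw [h₁, h₂]
  ring

end ProductChart

section Immersion

variable {E : Type*} [NormedAddCommGroup E] [NormedSpace ℝ E] [FiniteDimensional ℝ E]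
  {H : Type*} [TopologicalSpace H] {I : ModelWithCorners ℝ E H} [I.Boundaryless]
  {N : Type*} [TopologicalSpace N] [ChartedSpace H N] [IsManifold I ∞ N]
  {F : Type*} [NormedAddCommGroup F] [NormedSpace ℝ F] [FiniteDimensional ℝ F]
  {K : Type*} [TopologicalSpace K] {J : ModelWithCorners ℝ F K} [J.Boundaryless]
  {M : Type*} [TopologicalSpace M] [ChartedSpace K M] [IsManifold J ∞ M]

/-- The vector `t ∈ T_p N` with `g(t, w) = k(u, dφ(w))`, so that `dφ(t)` is the tangential part
of `u`. -/
noncomputable def tangentPart (g : RiemMetric I N) (k : RiemMetric J M) (φ : N → M) (p : N)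
    (u : TangentSpace J (φ p)) : TangentSpace I p :=
  sharp g p ((k.inner (φ p) u).comp (mfderiv I J φ p)).toLinearMap

theorem inner_tangentPart (g : RiemMetric I N) (k : RiemMetric J M) (φ : N → M) (p : N)
    (u : TangentSpace J (φ p)) (w : TangentSpace I p) :
    g.inner p (tangentPart g k φ p u) w = k.inner (φ p) u (mfderiv I J φ p w) :=
  inner_sharp g p _ w

theorem normalComponent_eq (g : RiemMetric I N) (k : RiemMetric J M) (φ : N → M) (p : N)
    (u : TangentSpace J (φ p)) :
    normalComponent g k φ p u = u - mfderiv I J φ p (tangentPart g k φ p u) := rfl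

theorem inner_normalComponent_comm (g : RiemMetric I N) (k : RiemMetric J M) (φ : N → M) (p : N)
    (u z : TangentSpace J (φ p)) :
    k.inner (φ p) (normalComponent g k φ p u) z = k.inner (φ p) u (normalComponent g k φ p z) := by
  rw [normalComponent_eq, normalComponent_eq, map_sub, map_sub, sub_apply,
    ← inner_tangentPart g k φ p u, k.symm _ (mfderiv I J φ p _) z, ← inner_tangentPart g k φ p z,
    g.symm]

theorem normalComponent_of_normal (g : RiemMetric I N) (k : RiemMetric J M) (φ : N → M) (p : N)
    (u : TangentSpace J (φ p)) (hu : ∀ v : TangentSpace I p, k.inner (φ p) u (mfderiv I J φ p v) = 0) :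
    normalComponent g k φ p u = u := by
  have h : tangentPart g k φ p u = 0 := metric_ext g p fun z => by
    rw [inner_tangentPart, hu, map_zero, zero_apply]
  rw [normalComponent_eq, h, map_zero, sub_zero]

theorem inner_gradient (k : RiemMetric J M) (f : M → ℝ) (q : M) (z : TangentSpace J q) :
    k.inner q (gradient k f q) z = mfderiv J 𝓘(ℝ, ℝ) f q z :=
  inner_sharp k q _ z

theorem WarpingFunction.mfderiv_log (ρ : WarpingFunction J M) (q : M) (z : TangentSpace J q) :
    (mfderiv J 𝓘(ℝ, ℝ) (fun x => Real.log (ρ.toFun x)) q z : ℝ) =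
      (ρ.toFun q)⁻¹ * ρ.diff q z := by
  have h := HasMFDerivAt.comp q
    ((Real.hasDerivAt_log (ρ.pos q).ne').hasFDerivAt.hasMFDerivAt)
    (ρ.mdifferentiableAt q).hasMFDerivAt
  refine (congrArg (fun L => L z) h.mfderiv).trans ?_
  exact mul_comm (ρ.diff q z) (ρ.toFun q)⁻¹

theorem WarpingFunction.diff_comp (ρ : WarpingFunction J M) {φ : N → M} (hφ : ContMDiff I J ∞ φ)
    (p : N) (v : TangentSpace I p) :
    (ρ.comp φ hφ).diff p v = ρ.diff (φ p) (mfderiv I J φ p v) :=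
  congrArg (fun L => L v)
    (mfderiv_comp p (ρ.mdifferentiableAt (φ p)) (hφ.mdifferentiableAt (x := p) (by simp)))

theorem WarpingFunction.diff_normalComponent (g : RiemMetric I N) (k : RiemMetric J M)
    (ρ : WarpingFunction J M) {φ : N → M} (hφ : ContMDiff I J ∞ φ) (p : N)
    (z : TangentSpace J (φ p)) :
    ρ.diff (φ p) (normalComponent g k φ p z) =
      ρ.diff (φ p) z - (ρ.comp φ hφ).diff p (tangentPart g k φ p z) := by
  rw [normalComponent_eq, map_sub, WarpingFunction.diff_comp]

theorem inner_tangentPart_right (g : RiemMetric I N) (k : RiemMetric J M) (φ : N → M) (p : N)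
    (u : TangentSpace J (φ p)) (w : TangentSpace I p) :
    g.inner p w (tangentPart g k φ p u) = k.inner (φ p) (mfderiv I J φ p w) u := by
  rw [g.symm, inner_tangentPart, k.symm]

theorem inner_normalGradient_log (g : RiemMetric I N) (k : RiemMetric J M) (φ : N → M)
    (ρ : WarpingFunction J M) (p : N) (z : TangentSpace J (φ p)) :
    k.inner (φ p) (normalGradient g k φ (fun x => Real.log (ρ.toFun x)) p) z =
      (ρ.toFun (φ p))⁻¹ * ρ.diff (φ p) (normalComponent g k φ p z) := by
  unfold normalGradient
  rw [inner_normalComponent_comm, inner_gradient]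
  exact ρ.mfderiv_log _ _

/-- The second derivative of `φ` in the charts around `p` and `φ(p)`. -/
noncomputable def chartHessian (I : ModelWithCorners ℝ E H) (J : ModelWithCorners ℝ F K)
    (φ : N → M) (p : N) (v w : TangentSpace I p) :
    TangentSpace J (φ p) :=
  fderiv ℝ (fderiv ℝ (writtenInExtChartAt I J p φ)) (extChartAt I p p) v w

theorem secondFundamentalForm_eq (g : RiemMetric I N) (k : RiemMetric J M) (φ : N → M) (p : N)
    (v w : TangentSpace I p) :
    secondFundamentalForm g k φ p v w = chartHessian I J φ p v w +
      christoffel k (φ p) (mfderiv I J φ p v) (mfderiv I J φ p w) -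
      mfderiv I J φ p (christoffel g p v w) := by
  have h : secondFundamentalForm g k φ p v w =
      frameAt J (φ p) (fderiv ℝ (fderiv ℝ (writtenInExtChartAt I J p φ)) (extChartAt I p p)
        (chartCoord I p p v) (chartCoord I p p w)) +
      christoffel k (φ p) (mfderiv I J φ p v) (mfderiv I J φ p w) -
      mfderiv I J φ p (christoffel g p v w) := rfl
  rw [h, chartCoord_self, frameAt_self]
  rfl

theorem inner_secondFundamentalForm (g : RiemMetric I N) (k : RiemMetric J M) (φ : N → M) (p : N)
    (v w : TangentSpace I p) (z : TangentSpace J (φ p)) :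
    k.inner (φ p) (secondFundamentalForm g k φ p v w) z =
      k.inner (φ p) (chartHessian I J φ p v w) z +
      k.inner (φ p) (christoffel k (φ p) (mfderiv I J φ p v) (mfderiv I J φ p w)) z -
      g.inner p (christoffel g p v w) (tangentPart g k φ p z) := by
  rw [secondFundamentalForm_eq, g.symm, inner_tangentPart, k.symm _ z]
  simp

theorem contDiffAt_writtenInExtChartAt {φ : N → M} (hφ : ContMDiff I J ∞ φ) (p : N) :
    ContDiffAt ℝ 2 (writtenInExtChartAt I J p φ) (extChartAt I p p) := by
  have h := (contMDiffAt_iff.1 (hφ p)).2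
  rw [I.range_eq_univ, contDiffWithinAt_univ] at h
  exact h.of_le (by norm_cast)

end Immersion

theorem warping_terms (r : ℝ) {A A' B B' Z T V Kw Gw Kv Gv KK GG : ℝ} (hA : A' = A) (hB : B' = B)
    (hw : Gw = Kw) (hv : Gv = Kv) (hg : KK = GG) (hV : V = Z - T) :
    r * (A * Kw + B * Kv - Z * KK) - r * (A' * Gw + B' * Gv - T * GG) = -(r * V * GG) := by
  subst hA hB hw hv hg hV
  ring

theorem sum_terms {r₁ r₂ S₁ S₂ D₁ D₂ C₁ C₂ G₁ G₂ X₁ X₂ Y₁ Y₂ W₁ W₂ : ℝ}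
    (h₁ : S₁ = D₁ + C₁ - G₁) (h₂ : S₂ = D₂ + C₂ - G₂)
    (hx₁ : X₂ - Y₂ = -W₂) (hx₂ : X₁ - Y₁ = -W₁) :
    r₂ * D₁ + r₁ * D₂ + (r₂ * C₁ + r₁ * C₂ + X₂ + X₁) - (r₂ * G₁ + r₁ * G₂ + Y₂ + Y₁) =
      r₂ * S₁ + r₁ * S₂ - W₂ - W₁ := by
  rw [h₁, h₂]
  linarith

section ProductImmersion

variable {E₁ : Type*} [NormedAddCommGroup E₁] [NormedSpace ℝ E₁] [FiniteDimensional ℝ E₁]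
  {H₁ : Type*} [TopologicalSpace H₁] {I₁ : ModelWithCorners ℝ E₁ H₁} [I₁.Boundaryless]
  {N₁ : Type*} [TopologicalSpace N₁] [ChartedSpace H₁ N₁] [IsManifold I₁ ∞ N₁]
  {E₂ : Type*} [NormedAddCommGroup E₂] [NormedSpace ℝ E₂] [FiniteDimensional ℝ E₂]
  {H₂ : Type*} [TopologicalSpace H₂] {I₂ : ModelWithCorners ℝ E₂ H₂} [I₂.Boundaryless]
  {N₂ : Type*} [TopologicalSpace N₂] [ChartedSpace H₂ N₂] [IsManifold I₂ ∞ N₂]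
  {F₁ : Type*} [NormedAddCommGroup F₁] [NormedSpace ℝ F₁] [FiniteDimensional ℝ F₁]
  {K₁ : Type*} [TopologicalSpace K₁] {J₁ : ModelWithCorners ℝ F₁ K₁} [J₁.Boundaryless]
  {M₁ : Type*} [TopologicalSpace M₁] [ChartedSpace K₁ M₁] [IsManifold J₁ ∞ M₁]
  {F₂ : Type*} [NormedAddCommGroup F₂] [NormedSpace ℝ F₂] [FiniteDimensional ℝ F₂]
  {K₂ : Type*} [TopologicalSpace K₂] {J₂ : ModelWithCorners ℝ F₂ K₂} [J₂.Boundaryless]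
  {M₂ : Type*} [TopologicalSpace M₂] [ChartedSpace K₂ M₂] [IsManifold J₂ ∞ M₂]
  (g₁ : RiemMetric I₁ N₁) (g₂ : RiemMetric I₂ N₂)
  (k₁ : RiemMetric J₁ M₁) (k₂ : RiemMetric J₂ M₂)
  (ρ₁ : WarpingFunction J₁ M₁) (ρ₂ : WarpingFunction J₂ M₂)
  {φ₁ : N₁ → M₁} {φ₂ : N₂ → M₂}
  (hφ₁ : ContMDiff I₁ J₁ ∞ φ₁) (hφ₂ : ContMDiff I₂ J₂ ∞ φ₂)

include hφ₁ hφ₂ in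
theorem mfderiv_prodMap_apply (p : N₁ × N₂) (v : TangentSpace (I₁.prod I₂) p) :
    mfderiv (I₁.prod I₂) (J₁.prod J₂) (Prod.map φ₁ φ₂) p v =
      (mfderiv I₁ J₁ φ₁ p.1 v.1, mfderiv I₂ J₂ φ₂ p.2 v.2) := by
  rw [mfderiv_prodMap (hφ₁.mdifferentiableAt (by simp)) (hφ₂.mdifferentiableAt (by simp))]
  rfl

include hφ₁ hφ₂ in
theorem chartHessian_prodMap (p : N₁ × N₂) (v w : TangentSpace (I₁.prod I₂) p) :
    chartHessian (I₁.prod I₂) (J₁.prod J₂) (Prod.map φ₁ φ₂) p v w =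
      (chartHessian I₁ J₁ φ₁ p.1 v.1 w.1, chartHessian I₂ J₂ φ₂ p.2 v.2 w.2) :=
  fderiv_fderiv_prodMap (y := (extChartAt I₁ p.1 p.1, extChartAt I₂ p.2 p.2))
    (contDiffAt_writtenInExtChartAt hφ₁ p.1) (contDiffAt_writtenInExtChartAt hφ₂ p.2) v w

theorem tangentPart_prodMap (p : N₁ × N₂)
    (u : TangentSpace (J₁.prod J₂) (Prod.map φ₁ φ₂ p)) :
    tangentPart (doublyWarped g₁ g₂ (ρ₁.comp φ₁ hφ₁) (ρ₂.comp φ₂ hφ₂)) (doublyWarped k₁ k₂ ρ₁ ρ₂)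
      (Prod.map φ₁ φ₂) p u = (tangentPart g₁ k₁ φ₁ p.1 u.1, tangentPart g₂ k₂ φ₂ p.2 u.2) := by
  refine metric_ext (doublyWarped g₁ g₂ (ρ₁.comp φ₁ hφ₁) (ρ₂.comp φ₂ hφ₂)) p fun z => ?_
  rw [inner_tangentPart, mfderiv_prodMap_apply hφ₁ hφ₂]
  refine (doublyWarped_apply k₁ k₂ ρ₁ ρ₂ (φ₁ p.1, φ₂ p.2) u _).trans ?_
  refine Eq.trans ?_ (doublyWarped_apply g₁ g₂ _ _ p
    (tangentPart g₁ k₁ φ₁ p.1 u.1, tangentPart g₂ k₂ φ₂ p.2 u.2) z).symm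
  exact congrArg₂ (fun a b : ℝ => (ρ₂.toFun (φ₂ p.2)) ^ 2 * a + (ρ₁.toFun (φ₁ p.1)) ^ 2 * b)
    (inner_tangentPart g₁ k₁ φ₁ p.1 u.1 z.1).symm (inner_tangentPart g₂ k₂ φ₂ p.2 u.2 z.2).symm

theorem normalComponent_prodMap (p : N₁ × N₂)
    (u : TangentSpace (J₁.prod J₂) (Prod.map φ₁ φ₂ p)) :
    normalComponent (doublyWarped g₁ g₂ (ρ₁.comp φ₁ hφ₁) (ρ₂.comp φ₂ hφ₂))
      (doublyWarped k₁ k₂ ρ₁ ρ₂) (Prod.map φ₁ φ₂) p u =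
      (normalComponent g₁ k₁ φ₁ p.1 u.1, normalComponent g₂ k₂ φ₂ p.2 u.2) := by
  rw [normalComponent_eq, tangentPart_prodMap]
  exact congrArg (u - ·) (mfderiv_prodMap_apply hφ₁ hφ₂ p
    (tangentPart g₁ k₁ φ₁ p.1 u.1, tangentPart g₂ k₂ φ₂ p.2 u.2))

theorem inner_secondFundamentalForm_prodMap (p : N₁ × N₂) (v w : TangentSpace (I₁.prod I₂) p)
    (z : TangentSpace (J₁.prod J₂) (Prod.map φ₁ φ₂ p))
    (hg₁ : ∀ v w, k₁.inner (φ₁ p.1) (mfderiv I₁ J₁ φ₁ p.1 v) (mfderiv I₁ J₁ φ₁ p.1 w) =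
      g₁.inner p.1 v w)
    (hg₂ : ∀ v w, k₂.inner (φ₂ p.2) (mfderiv I₂ J₂ φ₂ p.2 v) (mfderiv I₂ J₂ φ₂ p.2 w) =
      g₂.inner p.2 v w) :
    (doublyWarped k₁ k₂ ρ₁ ρ₂).inner (Prod.map φ₁ φ₂ p)
      (secondFundamentalForm (doublyWarped g₁ g₂ (ρ₁.comp φ₁ hφ₁) (ρ₂.comp φ₂ hφ₂))
        (doublyWarped k₁ k₂ ρ₁ ρ₂) (Prod.map φ₁ φ₂) p v w) z =
      ρ₂.toFun (φ₂ p.2) ^ 2 *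
        k₁.inner (φ₁ p.1) (secondFundamentalForm g₁ k₁ φ₁ p.1 v.1 w.1) z.1 +
      ρ₁.toFun (φ₁ p.1) ^ 2 *
        k₂.inner (φ₂ p.2) (secondFundamentalForm g₂ k₂ φ₂ p.2 v.2 w.2) z.2 -
      ρ₂.toFun (φ₂ p.2) * ρ₂.diff (φ₂ p.2) (normalComponent g₂ k₂ φ₂ p.2 z.2) *
        g₁.inner p.1 v.1 w.1 -
      ρ₁.toFun (φ₁ p.1) * ρ₁.diff (φ₁ p.1) (normalComponent g₁ k₁ φ₁ p.1 z.1) *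
        g₂.inner p.2 v.2 w.2 := by
  rw [inner_secondFundamentalForm, tangentPart_prodMap, mfderiv_prodMap_apply hφ₁ hφ₂,
    mfderiv_prodMap_apply hφ₁ hφ₂, chartHessian_prodMap hφ₁ hφ₂]
  have a₁ := doublyWarped_apply k₁ k₂ ρ₁ ρ₂ (φ₁ p.1, φ₂ p.2)
    (chartHessian I₁ J₁ φ₁ p.1 v.1 w.1, chartHessian I₂ J₂ φ₂ p.2 v.2 w.2) z
  have a₂ := inner_christoffel_doublyWarped k₁ k₂ ρ₁ ρ₂ (φ₁ p.1, φ₂ p.2)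
    (mfderiv I₁ J₁ φ₁ p.1 v.1, mfderiv I₂ J₂ φ₂ p.2 v.2)
    (mfderiv I₁ J₁ φ₁ p.1 w.1, mfderiv I₂ J₂ φ₂ p.2 w.2) z
  have a₃ := inner_christoffel_doublyWarped g₁ g₂ (ρ₁.comp φ₁ hφ₁) (ρ₂.comp φ₂ hφ₂) p v w
    (tangentPart g₁ k₁ φ₁ p.1 z.1, tangentPart g₂ k₂ φ₂ p.2 z.2)
  refine (congrArg₂ (fun s t : ℝ => s - t) (congrArg₂ (fun s t : ℝ => s + t) a₁ a₂) a₃).trans ?_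
  have b₁ := inner_secondFundamentalForm g₁ k₁ φ₁ p.1 v.1 w.1 z.1
  have b₂ := inner_secondFundamentalForm g₂ k₂ φ₂ p.2 v.2 w.2 z.2
  have c₁ := ρ₁.diff_normalComponent g₁ k₁ hφ₁ p.1 z.1
  have c₂ := ρ₂.diff_normalComponent g₂ k₂ hφ₂ p.2 z.2
  have d₁ := inner_tangentPart_right g₁ k₁ φ₁ p.1 z.1
  have d₂ := inner_tangentPart_right g₂ k₂ φ₂ p.2 z.2
  have x₁ := warping_terms (ρ₂.toFun (φ₂ p.2)) (ρ₂.diff_comp hφ₂ p.2 v.2)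
    (ρ₂.diff_comp hφ₂ p.2 w.2) (d₁ w.1) (d₁ v.1) (hg₁ v.1 w.1) c₂
  have x₂ := warping_terms (ρ₁.toFun (φ₁ p.1)) (ρ₁.diff_comp hφ₁ p.1 v.1)
    (ρ₁.diff_comp hφ₁ p.1 w.1) (d₂ w.2) (d₂ v.2) (hg₂ v.2 w.2) c₁
  exact sum_terms b₁ b₂ x₁ x₂

end ProductImmersion

section Immersion

variable {E : Type*} [NormedAddCommGroup E] [NormedSpace ℝ E] [FiniteDimensional ℝ E]
  {H : Type*} [TopologicalSpace H] {I : ModelWithCorners ℝ E H} [I.Boundaryless]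
  {N : Type*} [TopologicalSpace N] [ChartedSpace H N] [IsManifold I ∞ N]
  {F : Type*} [NormedAddCommGroup F] [NormedSpace ℝ F] [FiniteDimensional ℝ F]
  {K : Type*} [TopologicalSpace K] {J : ModelWithCorners ℝ F K} [J.Boundaryless]
  {M : Type*} [TopologicalSpace M] [ChartedSpace K M] [IsManifold J ∞ M]

theorem normalComponent_smul (g : RiemMetric I N) (k : RiemMetric J M) (φ : N → M) (p : N) (c : ℝ)
    (u : TangentSpace J (φ p)) :
    normalComponent g k φ p (c • u) = c • normalComponent g k φ p u := by
  have h : tangentPart g k φ p (c • u) = c • tangentPart g k φ p u := metric_ext g p fun z => by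
    rw [inner_tangentPart, map_smul, map_smul, smul_apply, smul_apply, inner_tangentPart]
  rw [normalComponent_eq, normalComponent_eq, h, map_smul, smul_sub]

theorem normalComponent_zero (g : RiemMetric I N) (k : RiemMetric J M) (φ : N → M) (p : N) :
    normalComponent g k φ p 0 = 0 := by
  simpa using normalComponent_smul g k φ p 0 0

theorem sharp_eq_sum (g : RiemMetric I N) (p : N) {ι : Type*} [Fintype ι]
    (b : Module.Basis ι ℝ (TangentSpace I p)) (α : Module.Dual ℝ (TangentSpace I p)) :
    sharp g p α = ∑ i, α (b i) • sharp g p (b.coord i) := by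
  classical
  have h : α = ∑ i, α (b i) • b.coord i := b.ext fun j => by
    simp
  conv_lhs => rw [h]
  simp only [map_sum, map_smul]

/-- The contraction of a bilinear map with the metric does not depend on the basis. -/
theorem sum_basis_sharp_eq (g : RiemMetric I N) (p : N) {V : Type*} [AddCommGroup V] [Module ℝ V]
    (B : TangentSpace I p →ₗ[ℝ] TangentSpace I p →ₗ[ℝ] V) {ι ι' : Type*} [Fintype ι] [Fintype ι']
    (b : Module.Basis ι ℝ (TangentSpace I p)) (b' : Module.Basis ι' ℝ (TangentSpace I p)) :
    ∑ i, B (b i) (sharp g p (b.coord i)) = ∑ j, B (b' j) (sharp g p (b'.coord j)) := by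
  simp only [sharp_eq_sum g p b' (b.coord _), map_sum, map_smul]
  rw [Finset.sum_comm]
  refine Finset.sum_congr rfl fun j _ => ?_
  have h := congrArg (fun x => B x (sharp g p (b'.coord j))) (b.sum_repr (b' j))
  simp only [map_sum, map_smul, LinearMap.sum_apply, LinearMap.smul_apply] at h
  exact h

theorem inner_basis_sharp (g : RiemMetric I N) (p : N) {ι : Type*}
    (b : Module.Basis ι ℝ (TangentSpace I p)) (i : ι) :
    g.inner p (b i) (sharp g p (b.coord i)) = 1 := by
  rw [g.symm, inner_sharp]
  simp

theorem shapeOperator_eq_smul_id_iff (g : RiemMetric I N) (k : RiemMetric J M) (φ : N → M) (p : N)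
    (ζ : TangentSpace J (φ p)) (c : ℝ) :
    shapeOperator g k φ p ζ = c • LinearMap.id ↔ ∀ v w : TangentSpace I p,
      k.inner (φ p) (secondFundamentalForm g k φ p v w) ζ = c * g.inner p v w := by
  constructor
  · intro h v w
    rw [← inner_shapeOperator, h]
    simp
  · intro h
    refine LinearMap.ext fun v => metric_ext g p fun w => ?_
    rw [inner_shapeOperator, h]
    simp

theorem inner_meanCurvature_of_umbilical [Nontrivial E] (g : RiemMetric I N) (k : RiemMetric J M)
    (φ : N → M) (p : N) (ζ : TangentSpace J (φ p)) (c : ℝ)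
    (h : ∀ v w : TangentSpace I p,
      k.inner (φ p) (secondFundamentalForm g k φ p v w) ζ = c * g.inner p v w) :
    k.inner (φ p) (meanCurvature g k φ p) ζ = c := by
  have hn : (Module.finrank ℝ E : ℝ) ≠ 0 := by
    exact_mod_cast (Module.finrank_pos (R := ℝ) (M := E)).ne'
  unfold meanCurvature
  simp only [map_smul, smul_apply, map_sum, sum_apply, h, inner_basis_sharp, smul_eq_mul]
  have hc : Module.finrank ℝ (TangentSpace I p) = Module.finrank ℝ E := rfl
  simp only [mul_one, Finset.sum_const, Finset.card_univ, Fintype.card_fin, nsmul_eq_mul, hc]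
  field_simp

theorem WarpingFunction.contMDiff_diff (ρ : WarpingFunction J M) :
    ContMDiff J.tangent 𝓘(ℝ, ℝ) ∞ (fun V : TangentBundle J M => ρ.diff V.1 V.2) := by
  have h := ρ.contMDiff.contMDiff_tangentMap (m := ∞) le_rfl
  exact contMDiff_snd_tangentBundle_modelSpace ℝ 𝓘(ℝ, ℝ) |>.comp h

end Immersion

section ProductImmersion

variable {E₁ : Type*} [NormedAddCommGroup E₁] [NormedSpace ℝ E₁] [FiniteDimensional ℝ E₁]
  {H₁ : Type*} [TopologicalSpace H₁] {I₁ : ModelWithCorners ℝ E₁ H₁} [I₁.Boundaryless]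
  {N₁ : Type*} [TopologicalSpace N₁] [ChartedSpace H₁ N₁] [IsManifold I₁ ∞ N₁]
  {E₂ : Type*} [NormedAddCommGroup E₂] [NormedSpace ℝ E₂] [FiniteDimensional ℝ E₂]
  {H₂ : Type*} [TopologicalSpace H₂] {I₂ : ModelWithCorners ℝ E₂ H₂} [I₂.Boundaryless]
  {N₂ : Type*} [TopologicalSpace N₂] [ChartedSpace H₂ N₂] [IsManifold I₂ ∞ N₂]
  {F₁ : Type*} [NormedAddCommGroup F₁] [NormedSpace ℝ F₁] [FiniteDimensional ℝ F₁]
  {K₁ : Type*} [TopologicalSpace K₁] {J₁ : ModelWithCorners ℝ F₁ K₁} [J₁.Boundaryless]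
  {M₁ : Type*} [TopologicalSpace M₁] [ChartedSpace K₁ M₁] [IsManifold J₁ ∞ M₁]
  {F₂ : Type*} [NormedAddCommGroup F₂] [NormedSpace ℝ F₂] [FiniteDimensional ℝ F₂]
  {K₂ : Type*} [TopologicalSpace K₂] {J₂ : ModelWithCorners ℝ F₂ K₂} [J₂.Boundaryless]
  {M₂ : Type*} [TopologicalSpace M₂] [ChartedSpace K₂ M₂] [IsManifold J₂ ∞ M₂]
  (g₁ : RiemMetric I₁ N₁) (g₂ : RiemMetric I₂ N₂)
  (k₁ : RiemMetric J₁ M₁) (k₂ : RiemMetric J₂ M₂)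
  (ρ₁ : WarpingFunction J₁ M₁) (ρ₂ : WarpingFunction J₂ M₂)
  {φ₁ : N₁ → M₁} {φ₂ : N₂ → M₂}

theorem WarpingFunction.mfderiv_log_fst (q : M₁ × M₂) (z : TangentSpace (J₁.prod J₂) q) :
    (mfderiv (J₁.prod J₂) 𝓘(ℝ, ℝ) (fun x : M₁ × M₂ => Real.log (ρ₁.toFun x.1)) q z : ℝ) =
      (ρ₁.toFun q.1)⁻¹ * ρ₁.diff q.1 z.1 := by
  have h := (ρ₁.comp Prod.fst (contMDiff_fst (J := J₂) (N := M₂))).mfderiv_log q z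
  rw [WarpingFunction.diff_comp, mfderiv_fst] at h
  exact h

theorem WarpingFunction.mfderiv_log_snd (q : M₁ × M₂) (z : TangentSpace (J₁.prod J₂) q) :
    (mfderiv (J₁.prod J₂) 𝓘(ℝ, ℝ) (fun x : M₁ × M₂ => Real.log (ρ₂.toFun x.2)) q z : ℝ) =
      (ρ₂.toFun q.2)⁻¹ * ρ₂.diff q.2 z.2 := by
  have h := (ρ₂.comp Prod.snd (contMDiff_snd (I := J₁) (M := M₁))).mfderiv_log q z
  rw [WarpingFunction.diff_comp, mfderiv_snd] at h
  exact h

theorem gradient_log_fst (q : M₁ × M₂) :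
    gradient (doublyWarped k₁ k₂ ρ₁ ρ₂) (fun x => Real.log (ρ₁.toFun x.1)) q =
      ((ρ₂.toFun q.2 ^ 2)⁻¹ • gradient k₁ (fun x => Real.log (ρ₁.toFun x)) q.1, 0) := by
  refine metric_ext (doublyWarped k₁ k₂ ρ₁ ρ₂) q fun z => ?_
  rw [inner_gradient]
  refine (ρ₁.mfderiv_log_fst q z).trans ?_
  refine Eq.trans ?_ (doublyWarped_apply k₁ k₂ ρ₁ ρ₂ q
    ((ρ₂.toFun q.2 ^ 2)⁻¹ • gradient k₁ (fun x => Real.log (ρ₁.toFun x)) q.1, 0) z).symm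
  have h : k₁.inner q.1 ((ρ₂.toFun q.2 ^ 2)⁻¹ • gradient k₁ (fun x => Real.log (ρ₁.toFun x)) q.1)
      z.1 = (ρ₂.toFun q.2 ^ 2)⁻¹ * ((ρ₁.toFun q.1)⁻¹ * ρ₁.diff q.1 z.1) := by
    rw [map_smul]
    exact congrArg ((ρ₂.toFun q.2 ^ 2)⁻¹ * ·)
      ((inner_gradient k₁ _ q.1 z.1).trans (ρ₁.mfderiv_log q.1 z.1))
  have h' : k₂.inner q.2 0 z.2 = 0 := by rw [map_zero]; rfl
  refine Eq.trans ?_ (congrArg₂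
    (fun s t : ℝ => ρ₂.toFun q.2 ^ 2 * s + ρ₁.toFun q.1 ^ 2 * t) h h').symm
  have := (ρ₂.pos q.2).ne'
  have := (ρ₁.pos q.1).ne'
  field_simp
  ring

theorem gradient_log_snd (q : M₁ × M₂) :
    gradient (doublyWarped k₁ k₂ ρ₁ ρ₂) (fun x => Real.log (ρ₂.toFun x.2)) q =
      (0, (ρ₁.toFun q.1 ^ 2)⁻¹ • gradient k₂ (fun x => Real.log (ρ₂.toFun x)) q.2) := by
  refine metric_ext (doublyWarped k₁ k₂ ρ₁ ρ₂) q fun z => ?_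
  rw [inner_gradient]
  refine (ρ₂.mfderiv_log_snd q z).trans ?_
  refine Eq.trans ?_ (doublyWarped_apply k₁ k₂ ρ₁ ρ₂ q
    (0, (ρ₁.toFun q.1 ^ 2)⁻¹ • gradient k₂ (fun x => Real.log (ρ₂.toFun x)) q.2) z).symm
  have h : k₂.inner q.2 ((ρ₁.toFun q.1 ^ 2)⁻¹ • gradient k₂ (fun x => Real.log (ρ₂.toFun x)) q.2)
      z.2 = (ρ₁.toFun q.1 ^ 2)⁻¹ * ((ρ₂.toFun q.2)⁻¹ * ρ₂.diff q.2 z.2) := by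
    rw [map_smul]
    exact congrArg ((ρ₁.toFun q.1 ^ 2)⁻¹ * ·)
      ((inner_gradient k₂ _ q.2 z.2).trans (ρ₂.mfderiv_log q.2 z.2))
  have h' : k₁.inner q.1 0 z.1 = 0 := by rw [map_zero]; rfl
  refine Eq.trans ?_ (congrArg₂
    (fun s t : ℝ => ρ₂.toFun q.2 ^ 2 * s + ρ₁.toFun q.1 ^ 2 * t) h' h).symm
  have := (ρ₂.pos q.2).ne'
  have := (ρ₁.pos q.1).ne'
  field_simp
  ring

variable (hφ₁ : ContMDiff I₁ J₁ ∞ φ₁) (hφ₂ : ContMDiff I₂ J₂ ∞ φ₂)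

theorem normalGradient_log_fst (p : N₁ × N₂) :
    normalGradient (doublyWarped g₁ g₂ (ρ₁.comp φ₁ hφ₁) (ρ₂.comp φ₂ hφ₂))
      (doublyWarped k₁ k₂ ρ₁ ρ₂) (Prod.map φ₁ φ₂) (fun x => Real.log (ρ₁.toFun x.1)) p =
      ((ρ₂.toFun (φ₂ p.2) ^ 2)⁻¹ •
        normalGradient g₁ k₁ φ₁ (fun x => Real.log (ρ₁.toFun x)) p.1, 0) := by
  unfold normalGradient
  rw [normalComponent_prodMap, gradient_log_fst]
  exact Prod.ext (normalComponent_smul g₁ k₁ φ₁ p.1 _ _) (normalComponent_zero g₂ k₂ φ₂ p.2)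

theorem normalGradient_log_snd (p : N₁ × N₂) :
    normalGradient (doublyWarped g₁ g₂ (ρ₁.comp φ₁ hφ₁) (ρ₂.comp φ₂ hφ₂))
      (doublyWarped k₁ k₂ ρ₁ ρ₂) (Prod.map φ₁ φ₂) (fun x => Real.log (ρ₂.toFun x.2)) p =
      (0, (ρ₁.toFun (φ₁ p.1) ^ 2)⁻¹ •
        normalGradient g₂ k₂ φ₂ (fun x => Real.log (ρ₂.toFun x)) p.2) := by
  unfold normalGradient
  rw [normalComponent_prodMap, gradient_log_snd]
  exact Prod.ext (normalComponent_zero g₁ k₁ φ₁ p.1) (normalComponent_smul g₂ k₂ φ₂ p.2 _ _)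

theorem warping_coefficient {r s a b d : ℝ} (hs : s ≠ 0) :
    s ^ 2 * (a - (r ^ 2 / s ^ 2 * b) * (r⁻¹ * d)) = s ^ 2 * a - r * d * b := by
  field_simp

theorem secondFundamentalForm_prodMap (p : N₁ × N₂) (v w : TangentSpace (I₁.prod I₂) p)
    (hg₁ : ∀ v w, k₁.inner (φ₁ p.1) (mfderiv I₁ J₁ φ₁ p.1 v) (mfderiv I₁ J₁ φ₁ p.1 w) =
      g₁.inner p.1 v w)
    (hg₂ : ∀ v w, k₂.inner (φ₂ p.2) (mfderiv I₂ J₂ φ₂ p.2 v) (mfderiv I₂ J₂ φ₂ p.2 w) =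
      g₂.inner p.2 v w) :
    secondFundamentalForm (doublyWarped g₁ g₂ (ρ₁.comp φ₁ hφ₁) (ρ₂.comp φ₂ hφ₂))
        (doublyWarped k₁ k₂ ρ₁ ρ₂) (Prod.map φ₁ φ₂) p v w =
      (secondFundamentalForm g₁ k₁ φ₁ p.1 v.1 w.1 -
        (ρ₁.toFun (φ₁ p.1) ^ 2 / ρ₂.toFun (φ₂ p.2) ^ 2 * g₂.inner p.2 v.2 w.2) •
          normalGradient g₁ k₁ φ₁ (fun x => Real.log (ρ₁.toFun x)) p.1,
      secondFundamentalForm g₂ k₂ φ₂ p.2 v.2 w.2 -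
        (ρ₂.toFun (φ₂ p.2) ^ 2 / ρ₁.toFun (φ₁ p.1) ^ 2 * g₁.inner p.1 v.1 w.1) •
          normalGradient g₂ k₂ φ₂ (fun x => Real.log (ρ₂.toFun x)) p.2) := by
  refine metric_ext (doublyWarped k₁ k₂ ρ₁ ρ₂) (φ₁ p.1, φ₂ p.2) fun z => ?_
  refine (inner_secondFundamentalForm_prodMap g₁ g₂ k₁ k₂ ρ₁ ρ₂ hφ₁ hφ₂ p v w z hg₁ hg₂).trans ?_
  refine Eq.trans ?_ (doublyWarped_apply k₁ k₂ ρ₁ ρ₂ (φ₁ p.1, φ₂ p.2) _ z).symm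
  have h₁ : ∀ (h : TangentSpace J₁ (φ₁ p.1)) (c : ℝ) (z : TangentSpace J₁ (φ₁ p.1)),
      k₁.inner (φ₁ p.1) (h - c • normalGradient g₁ k₁ φ₁ (fun x => Real.log (ρ₁.toFun x)) p.1) z =
        k₁.inner (φ₁ p.1) h z - c * ((ρ₁.toFun (φ₁ p.1))⁻¹ *
          ρ₁.diff (φ₁ p.1) (normalComponent g₁ k₁ φ₁ p.1 z)) := by
    intro h c z
    rw [← inner_normalGradient_log]
    simp
  have h₂ : ∀ (h : TangentSpace J₂ (φ₂ p.2)) (c : ℝ) (z : TangentSpace J₂ (φ₂ p.2)),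
      k₂.inner (φ₂ p.2) (h - c • normalGradient g₂ k₂ φ₂ (fun x => Real.log (ρ₂.toFun x)) p.2) z =
        k₂.inner (φ₂ p.2) h z - c * ((ρ₂.toFun (φ₂ p.2))⁻¹ *
          ρ₂.diff (φ₂ p.2) (normalComponent g₂ k₂ φ₂ p.2 z)) := by
    intro h c z
    rw [← inner_normalGradient_log]
    simp
  refine Eq.trans ?_ (congrArg₂
    (fun s t : ℝ => ρ₂.toFun (φ₂ p.2) ^ 2 * s + ρ₁.toFun (φ₁ p.1) ^ 2 * t)
    (h₁ _ _ z.1) (h₂ _ _ z.2)).symm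
  have n₁ := (ρ₁.pos (φ₁ p.1)).ne'
  have n₂ := (ρ₂.pos (φ₂ p.2)).ne'
  refine Eq.trans ?_ (congrArg₂ (fun s t : ℝ => s + t)
    (warping_coefficient n₂) (warping_coefficient n₁)).symm
  ring

end ProductImmersion

section ProductImmersion

variable {E₁ : Type*} [NormedAddCommGroup E₁] [NormedSpace ℝ E₁] [FiniteDimensional ℝ E₁]
  {H₁ : Type*} [TopologicalSpace H₁] {I₁ : ModelWithCorners ℝ E₁ H₁} [I₁.Boundaryless]
  {N₁ : Type*} [TopologicalSpace N₁] [ChartedSpace H₁ N₁] [IsManifold I₁ ∞ N₁]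
  {E₂ : Type*} [NormedAddCommGroup E₂] [NormedSpace ℝ E₂] [FiniteDimensional ℝ E₂]
  {H₂ : Type*} [TopologicalSpace H₂] {I₂ : ModelWithCorners ℝ E₂ H₂} [I₂.Boundaryless]
  {N₂ : Type*} [TopologicalSpace N₂] [ChartedSpace H₂ N₂] [IsManifold I₂ ∞ N₂]
  {F₁ : Type*} [NormedAddCommGroup F₁] [NormedSpace ℝ F₁] [FiniteDimensional ℝ F₁]
  {K₁ : Type*} [TopologicalSpace K₁] {J₁ : ModelWithCorners ℝ F₁ K₁} [J₁.Boundaryless]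
  {M₁ : Type*} [TopologicalSpace M₁] [ChartedSpace K₁ M₁] [IsManifold J₁ ∞ M₁]
  {F₂ : Type*} [NormedAddCommGroup F₂] [NormedSpace ℝ F₂] [FiniteDimensional ℝ F₂]
  {K₂ : Type*} [TopologicalSpace K₂] {J₂ : ModelWithCorners ℝ F₂ K₂} [J₂.Boundaryless]
  {M₂ : Type*} [TopologicalSpace M₂] [ChartedSpace K₂ M₂] [IsManifold J₂ ∞ M₂]
  (g₁ : RiemMetric I₁ N₁) (g₂ : RiemMetric I₂ N₂)
  (k₁ : RiemMetric J₁ M₁) (k₂ : RiemMetric J₂ M₂)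

/-- A basis of the tangent space of a product adapted to the factors. -/
noncomputable def tangentBasisProd (p : N₁ × N₂) :
    Module.Basis (Fin (Module.finrank ℝ (TangentSpace I₁ p.1)) ⊕
      Fin (Module.finrank ℝ (TangentSpace I₂ p.2))) ℝ (TangentSpace (I₁.prod I₂) p) :=
  (Module.finBasis ℝ (TangentSpace I₁ p.1)).prod (Module.finBasis ℝ (TangentSpace I₂ p.2))

theorem tangentBasisProd_inl (p : N₁ × N₂) (i) :
    tangentBasisProd (I₁ := I₁) (I₂ := I₂) p (Sum.inl i) =
      (Module.finBasis ℝ (TangentSpace I₁ p.1) i, 0) :=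
  Prod.ext
    (Module.Basis.prod_apply_inl_fst (Module.finBasis ℝ (TangentSpace I₁ p.1))
      (Module.finBasis ℝ (TangentSpace I₂ p.2)) i)
    (Module.Basis.prod_apply_inl_snd (Module.finBasis ℝ (TangentSpace I₁ p.1))
      (Module.finBasis ℝ (TangentSpace I₂ p.2)) i)

theorem tangentBasisProd_inr (p : N₁ × N₂) (i) :
    tangentBasisProd (I₁ := I₁) (I₂ := I₂) p (Sum.inr i) =
      (0, Module.finBasis ℝ (TangentSpace I₂ p.2) i) :=
  Prod.ext
    (Module.Basis.prod_apply_inr_fst (Module.finBasis ℝ (TangentSpace I₁ p.1))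
      (Module.finBasis ℝ (TangentSpace I₂ p.2)) i)
    (Module.Basis.prod_apply_inr_snd (Module.finBasis ℝ (TangentSpace I₁ p.1))
      (Module.finBasis ℝ (TangentSpace I₂ p.2)) i)

theorem inner_smul_sharp {E H N : Type*} [NormedAddCommGroup E] [NormedSpace ℝ E]
    [FiniteDimensional ℝ E] [TopologicalSpace H] {I : ModelWithCorners ℝ E H} [TopologicalSpace N]
    [ChartedSpace H N] [IsManifold I ∞ N] (g : RiemMetric I N) (p : N) {r : ℝ} (hr : r ≠ 0)
    (α : Module.Dual ℝ (TangentSpace I p)) (z : TangentSpace I p) :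
    r ^ 2 * g.inner p ((r ^ 2)⁻¹ • sharp g p α) z = α z := by
  rw [map_smul, smul_apply, inner_sharp, smul_eq_mul]
  field_simp

theorem sharp_tangentBasisProd_inl (f₁ : WarpingFunction I₁ N₁) (f₂ : WarpingFunction I₂ N₂)
    (p : N₁ × N₂) (i) :
    sharp (doublyWarped g₁ g₂ f₁ f₂) p ((tangentBasisProd p).coord (Sum.inl i)) =
      ((f₂.toFun p.2 ^ 2)⁻¹ •
        sharp g₁ p.1 ((Module.finBasis ℝ (TangentSpace I₁ p.1)).coord i), 0) := by
  refine metric_ext (doublyWarped g₁ g₂ f₁ f₂) p fun z => ?_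
  rw [inner_sharp]
  refine Eq.trans ?_ (doublyWarped_apply g₁ g₂ f₁ f₂ p ((f₂.toFun p.2 ^ 2)⁻¹ •
        sharp g₁ p.1 ((Module.finBasis ℝ (TangentSpace I₁ p.1)).coord i), 0) z).symm
  have h' : g₂.inner p.2 0 z.2 = 0 := by rw [map_zero]; rfl
  refine Eq.trans ?_ (congrArg₂ (fun s t : ℝ => s + f₁.toFun p.1 ^ 2 * t)
    (inner_smul_sharp g₁ p.1 (f₂.pos p.2).ne' _ z.1) h').symm
  rw [mul_zero, add_zero]
  rfl

theorem sharp_tangentBasisProd_inr (f₁ : WarpingFunction I₁ N₁) (f₂ : WarpingFunction I₂ N₂)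
    (p : N₁ × N₂) (i) :
    sharp (doublyWarped g₁ g₂ f₁ f₂) p ((tangentBasisProd p).coord (Sum.inr i)) =
      (0, (f₁.toFun p.1 ^ 2)⁻¹ •
        sharp g₂ p.2 ((Module.finBasis ℝ (TangentSpace I₂ p.2)).coord i)) := by
  refine metric_ext (doublyWarped g₁ g₂ f₁ f₂) p fun z => ?_
  rw [inner_sharp]
  refine Eq.trans ?_ (doublyWarped_apply g₁ g₂ f₁ f₂ p (0, (f₁.toFun p.1 ^ 2)⁻¹ •
        sharp g₂ p.2 ((Module.finBasis ℝ (TangentSpace I₂ p.2)).coord i)) z).symm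
  have h' : g₁.inner p.1 0 z.1 = 0 := by rw [map_zero]; rfl
  refine Eq.trans ?_ (congrArg₂ (fun s t : ℝ => f₂.toFun p.2 ^ 2 * s + t)
    h' (inner_smul_sharp g₂ p.2 (f₁.pos p.1).ne' _ z.2)).symm
  rw [mul_zero, zero_add]
  rfl

variable (ρ₁ : WarpingFunction J₁ M₁) (ρ₂ : WarpingFunction J₂ M₂)
  {φ₁ : N₁ → M₁} {φ₂ : N₂ → M₂}
  (hφ₁ : ContMDiff I₁ J₁ ∞ φ₁) (hφ₂ : ContMDiff I₂ J₂ ∞ φ₂)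

theorem finrank_smul_meanCurvature {E H N F K M : Type*} [NormedAddCommGroup E] [NormedSpace ℝ E]
    [FiniteDimensional ℝ E] [Nontrivial E] [TopologicalSpace H] {I : ModelWithCorners ℝ E H}
    [TopologicalSpace N] [ChartedSpace H N] [IsManifold I ∞ N]
    [NormedAddCommGroup F] [NormedSpace ℝ F] [FiniteDimensional ℝ F] [TopologicalSpace K]
    {J : ModelWithCorners ℝ F K} [TopologicalSpace M] [ChartedSpace K M] [IsManifold J ∞ M]
    (g : RiemMetric I N) (k : RiemMetric J M) (φ : N → M) (p : N) :
    (Module.finrank ℝ E : ℝ) • meanCurvature g k φ p = ∑ i, secondFundamentalForm g k φ p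
      (Module.finBasis ℝ (TangentSpace I p) i)
      (sharp g p ((Module.finBasis ℝ (TangentSpace I p)).coord i)) := by
  have hn : (Module.finrank ℝ E : ℝ) ≠ 0 := by
    exact_mod_cast (Module.finrank_pos (R := ℝ) (M := E)).ne'
  exact smul_inv_smul₀ hn _

theorem sum_smul_add_sum_neg {V ι : Type*} [Fintype ι] [AddCommGroup V] [Module ℝ V] {n : ℕ}
    (c : ℝ) (f : ι → V) (D : V) :
    ∑ i, c • f i + ∑ _i : Fin n, -(c • D) = c • (∑ i, f i - (n : ℝ) • D) := by
  rw [Finset.sum_const, Finset.card_univ, Fintype.card_fin, ← Nat.cast_smul_eq_nsmul ℝ,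
    ← Finset.smul_sum]
  module

/-- The mean curvature vector of a doubly warped product immersion. -/
theorem finrank_smul_meanCurvature_prodMap [Nontrivial E₁] [Nontrivial E₂] (p : N₁ × N₂)
    (hg₁ : ∀ v w, k₁.inner (φ₁ p.1) (mfderiv I₁ J₁ φ₁ p.1 v) (mfderiv I₁ J₁ φ₁ p.1 w) =
      g₁.inner p.1 v w)
    (hg₂ : ∀ v w, k₂.inner (φ₂ p.2) (mfderiv I₂ J₂ φ₂ p.2 v) (mfderiv I₂ J₂ φ₂ p.2 w) =
      g₂.inner p.2 v w) :
    (Module.finrank ℝ (E₁ × E₂) : ℝ) •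
      meanCurvature (doublyWarped g₁ g₂ (ρ₁.comp φ₁ hφ₁) (ρ₂.comp φ₂ hφ₂))
        (doublyWarped k₁ k₂ ρ₁ ρ₂) (Prod.map φ₁ φ₂) p =
      ((ρ₂.toFun (φ₂ p.2) ^ 2)⁻¹ • ((Module.finrank ℝ E₁ : ℝ) • meanCurvature g₁ k₁ φ₁ p.1 -
        (Module.finrank ℝ E₂ : ℝ) • normalGradient g₁ k₁ φ₁ (fun x => Real.log (ρ₁.toFun x)) p.1),
      (ρ₁.toFun (φ₁ p.1) ^ 2)⁻¹ • ((Module.finrank ℝ E₂ : ℝ) • meanCurvature g₂ k₂ φ₂ p.2 -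
        (Module.finrank ℝ E₁ : ℝ) •
          normalGradient g₂ k₂ φ₂ (fun x => Real.log (ρ₂.toFun x)) p.2)) := by
  have n₁ := (ρ₁.pos (φ₁ p.1)).ne'
  have n₂ := (ρ₂.pos (φ₂ p.2)).ne'
  rw [finrank_smul_meanCurvature, sum_basis_sharp_eq _ p _ _ (tangentBasisProd p),
    Fintype.sum_sum_type, finrank_smul_meanCurvature, finrank_smul_meanCurvature]
  set b₁ := Module.finBasis ℝ (TangentSpace I₁ p.1) with hb₁
  set b₂ := Module.finBasis ℝ (TangentSpace I₂ p.2) with hb₂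
  set D₁ := normalGradient g₁ k₁ φ₁ (fun x => Real.log (ρ₁.toFun x)) p.1 with hD₁
  set D₂ := normalGradient g₂ k₂ φ₂ (fun x => Real.log (ρ₂.toFun x)) p.2 with hD₂
  have hl : ∀ i, secondFundamentalForm (doublyWarped g₁ g₂ (ρ₁.comp φ₁ hφ₁) (ρ₂.comp φ₂ hφ₂))
        (doublyWarped k₁ k₂ ρ₁ ρ₂) (Prod.map φ₁ φ₂) p (tangentBasisProd p (Sum.inl i))
        (sharp (doublyWarped g₁ g₂ (ρ₁.comp φ₁ hφ₁) (ρ₂.comp φ₂ hφ₂)) p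
          ((tangentBasisProd p).coord (Sum.inl i))) =
      ((ρ₂.toFun (φ₂ p.2) ^ 2)⁻¹ •
        secondFundamentalForm g₁ k₁ φ₁ p.1 (b₁ i) (sharp g₁ p.1 (b₁.coord i)),
      -((ρ₁.toFun (φ₁ p.1) ^ 2)⁻¹ • D₂)) := by
    intro i
    rw [tangentBasisProd_inl, sharp_tangentBasisProd_inl]
    refine (secondFundamentalForm_prodMap g₁ g₂ k₁ k₂ ρ₁ ρ₂ hφ₁ hφ₂ p (b₁ i, 0)
      ((ρ₂.toFun (φ₂ p.2) ^ 2)⁻¹ • sharp g₁ p.1 (b₁.coord i), 0) hg₁ hg₂).trans ?_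
    refine Prod.ext ?_ ?_
    · change secondFundamentalForm g₁ k₁ φ₁ p.1 (b₁ i)
          ((ρ₂.toFun (φ₂ p.2) ^ 2)⁻¹ • sharp g₁ p.1 (b₁.coord i)) -
        (ρ₁.toFun (φ₁ p.1) ^ 2 / ρ₂.toFun (φ₂ p.2) ^ 2 * g₂.inner p.2 0 0) • D₁ = _
      rw [map_zero, map_smul, mul_zero, zero_smul, sub_zero]
    · change secondFundamentalForm g₂ k₂ φ₂ p.2 0 0 -
        (ρ₂.toFun (φ₂ p.2) ^ 2 / ρ₁.toFun (φ₁ p.1) ^ 2 * g₁.inner p.1 (b₁ i)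
          ((ρ₂.toFun (φ₂ p.2) ^ 2)⁻¹ • sharp g₁ p.1 (b₁.coord i))) • D₂ = _
      rw [map_zero, map_smul, inner_basis_sharp, zero_sub, smul_eq_mul]
      congr 2
      field_simp
  have hr : ∀ i, secondFundamentalForm (doublyWarped g₁ g₂ (ρ₁.comp φ₁ hφ₁) (ρ₂.comp φ₂ hφ₂))
        (doublyWarped k₁ k₂ ρ₁ ρ₂) (Prod.map φ₁ φ₂) p (tangentBasisProd p (Sum.inr i))
        (sharp (doublyWarped g₁ g₂ (ρ₁.comp φ₁ hφ₁) (ρ₂.comp φ₂ hφ₂)) p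
          ((tangentBasisProd p).coord (Sum.inr i))) =
      (-((ρ₂.toFun (φ₂ p.2) ^ 2)⁻¹ • D₁), (ρ₁.toFun (φ₁ p.1) ^ 2)⁻¹ •
        secondFundamentalForm g₂ k₂ φ₂ p.2 (b₂ i) (sharp g₂ p.2 (b₂.coord i))) := by
    intro i
    rw [tangentBasisProd_inr, sharp_tangentBasisProd_inr]
    refine (secondFundamentalForm_prodMap g₁ g₂ k₁ k₂ ρ₁ ρ₂ hφ₁ hφ₂ p (0, b₂ i)
      (0, (ρ₁.toFun (φ₁ p.1) ^ 2)⁻¹ • sharp g₂ p.2 (b₂.coord i)) hg₁ hg₂).trans ?_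
    refine Prod.ext ?_ ?_
    · change secondFundamentalForm g₁ k₁ φ₁ p.1 0 0 -
        (ρ₁.toFun (φ₁ p.1) ^ 2 / ρ₂.toFun (φ₂ p.2) ^ 2 * g₂.inner p.2 (b₂ i)
          ((ρ₁.toFun (φ₁ p.1) ^ 2)⁻¹ • sharp g₂ p.2 (b₂.coord i))) • D₁ = _
      rw [map_zero, map_smul, inner_basis_sharp, zero_sub, smul_eq_mul]
      congr 2
      field_simp
    · change secondFundamentalForm g₂ k₂ φ₂ p.2 (b₂ i)
          ((ρ₁.toFun (φ₁ p.1) ^ 2)⁻¹ • sharp g₂ p.2 (b₂.coord i)) -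
        (ρ₂.toFun (φ₂ p.2) ^ 2 / ρ₁.toFun (φ₁ p.1) ^ 2 * g₁.inner p.1 0 0) • D₂ = _
      rw [map_zero, map_smul, mul_zero, zero_smul, sub_zero]
  refine (congrArg₂ (· + ·) (Finset.sum_congr rfl fun i _ => hl i)
    (Finset.sum_congr rfl fun i _ => hr i)).trans ?_
  refine Prod.ext ?_ ?_
  · refine (congrArg₂ (· + ·) Prod.fst_sum Prod.fst_sum).trans ?_
    exact sum_smul_add_sum_neg _ _ _
  · refine (congrArg₂ (· + ·) Prod.snd_sum Prod.snd_sum).trans ?_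
    exact (add_comm _ _).trans (sum_smul_add_sum_neg _ _ _)

theorem smul_sub_smul_eq_iff {V : Type*} [AddCommGroup V] [Module ℝ V] {a b c : ℝ} (ha : a ≠ 0)
    (hc : c ≠ 0) (H D : V) :
    c • (a • H - b • D) = (a + b) • -(c • D) ↔ H = -D := by
  have e : (a + b) • -(c • D) = c • (-(a • D) - b • D) := by module
  rw [e, smul_right_inj hc, sub_left_inj, ← smul_neg, smul_right_inj ha]

theorem meanCurvature_prodMap_eq_iff [Nontrivial E₁] [Nontrivial E₂] (p : N₁ × N₂)
    (hg₁ : ∀ v w, k₁.inner (φ₁ p.1) (mfderiv I₁ J₁ φ₁ p.1 v) (mfderiv I₁ J₁ φ₁ p.1 w) =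
      g₁.inner p.1 v w)
    (hg₂ : ∀ v w, k₂.inner (φ₂ p.2) (mfderiv I₂ J₂ φ₂ p.2 v) (mfderiv I₂ J₂ φ₂ p.2 w) =
      g₂.inner p.2 v w) :
    meanCurvature (doublyWarped g₁ g₂ (ρ₁.comp φ₁ hφ₁) (ρ₂.comp φ₂ hφ₂))
        (doublyWarped k₁ k₂ ρ₁ ρ₂) (Prod.map φ₁ φ₂) p =
      -(normalGradient (doublyWarped g₁ g₂ (ρ₁.comp φ₁ hφ₁) (ρ₂.comp φ₂ hφ₂))
          (doublyWarped k₁ k₂ ρ₁ ρ₂) (Prod.map φ₁ φ₂) (fun x => Real.log (ρ₁.toFun x.1)) p +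
        normalGradient (doublyWarped g₁ g₂ (ρ₁.comp φ₁ hφ₁) (ρ₂.comp φ₂ hφ₂))
          (doublyWarped k₁ k₂ ρ₁ ρ₂) (Prod.map φ₁ φ₂) (fun x => Real.log (ρ₂.toFun x.2)) p) ↔
      meanCurvature g₁ k₁ φ₁ p.1 =
        -normalGradient g₁ k₁ φ₁ (fun x => Real.log (ρ₁.toFun x)) p.1 ∧
      meanCurvature g₂ k₂ φ₂ p.2 =
        -normalGradient g₂ k₂ φ₂ (fun x => Real.log (ρ₂.toFun x)) p.2 := by
  have m₁ : (Module.finrank ℝ E₁ : ℝ) ≠ 0 := by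
    exact_mod_cast (Module.finrank_pos (R := ℝ) (M := E₁)).ne'
  have m₂ : (Module.finrank ℝ E₂ : ℝ) ≠ 0 := by
    exact_mod_cast (Module.finrank_pos (R := ℝ) (M := E₂)).ne'
  have m : (Module.finrank ℝ (E₁ × E₂) : ℝ) ≠ 0 := by
    exact_mod_cast (Module.finrank_pos (R := ℝ) (M := E₁ × E₂)).ne'
  have hm : (Module.finrank ℝ (E₁ × E₂) : ℝ) = Module.finrank ℝ E₁ + Module.finrank ℝ E₂ := by
    rw [Module.finrank_prod]
    push_cast
    rfl
  have n₁ := (ρ₁.pos (φ₁ p.1)).ne'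
  have n₂ := (ρ₂.pos (φ₂ p.2)).ne'
  rw [← smul_right_inj m, finrank_smul_meanCurvature_prodMap g₁ g₂ k₁ k₂ ρ₁ ρ₂ hφ₁ hφ₂ p hg₁ hg₂,
    normalGradient_log_fst, normalGradient_log_snd]
  refine Prod.ext_iff.trans (and_congr ?_ ?_)
  · refine Iff.trans ?_ (smul_sub_smul_eq_iff (b := (Module.finrank ℝ E₂ : ℝ)) m₁
      (inv_ne_zero (pow_ne_zero 2 n₂)) _ _)
    rw [← hm]
    refine Eq.congr_right ?_
    refine congrArg (fun u : TangentSpace J₁ (φ₁ p.1) =>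
      (Module.finrank ℝ (E₁ × E₂) : ℝ) • -u) (add_zero _)
  · refine Iff.trans ?_ (smul_sub_smul_eq_iff (b := (Module.finrank ℝ E₁ : ℝ)) m₂
      (inv_ne_zero (pow_ne_zero 2 n₁)) _ _)
    rw [add_comm, ← hm]
    refine Eq.congr_right ?_
    refine congrArg (fun u : TangentSpace J₂ (φ₂ p.2) =>
      (Module.finrank ℝ (E₁ × E₂) : ℝ) • -u) (zero_add _)

end ProductImmersion

section ProductImmersion

variable {E₁ : Type*} [NormedAddCommGroup E₁] [NormedSpace ℝ E₁] [FiniteDimensional ℝ E₁]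
  {H₁ : Type*} [TopologicalSpace H₁] {I₁ : ModelWithCorners ℝ E₁ H₁} [I₁.Boundaryless]
  {N₁ : Type*} [TopologicalSpace N₁] [ChartedSpace H₁ N₁] [IsManifold I₁ ∞ N₁]
  {E₂ : Type*} [NormedAddCommGroup E₂] [NormedSpace ℝ E₂] [FiniteDimensional ℝ E₂]
  {H₂ : Type*} [TopologicalSpace H₂] {I₂ : ModelWithCorners ℝ E₂ H₂} [I₂.Boundaryless]
  {N₂ : Type*} [TopologicalSpace N₂] [ChartedSpace H₂ N₂] [IsManifold I₂ ∞ N₂]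
  {F₁ : Type*} [NormedAddCommGroup F₁] [NormedSpace ℝ F₁] [FiniteDimensional ℝ F₁]
  {K₁ : Type*} [TopologicalSpace K₁] {J₁ : ModelWithCorners ℝ F₁ K₁} [J₁.Boundaryless]
  {M₁ : Type*} [TopologicalSpace M₁] [ChartedSpace K₁ M₁] [IsManifold J₁ ∞ M₁]
  {F₂ : Type*} [NormedAddCommGroup F₂] [NormedSpace ℝ F₂] [FiniteDimensional ℝ F₂]
  {K₂ : Type*} [TopologicalSpace K₂] {J₂ : ModelWithCorners ℝ F₂ K₂} [J₂.Boundaryless]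
  {M₂ : Type*} [TopologicalSpace M₂] [ChartedSpace K₂ M₂] [IsManifold J₂ ∞ M₂]
  {g₁ : RiemMetric I₁ N₁} {g₂ : RiemMetric I₂ N₂}
  {k₁ : RiemMetric J₁ M₁} {k₂ : RiemMetric J₂ M₂}
  {ρ₁ : WarpingFunction J₁ M₁} {ρ₂ : WarpingFunction J₂ M₂}
  {φ₁ : N₁ → M₁} {φ₂ : N₂ → M₂}

theorem inner_mfderiv_prodMap (k₁ : RiemMetric J₁ M₁) (k₂ : RiemMetric J₂ M₂)
    (ρ₁ : WarpingFunction J₁ M₁) (ρ₂ : WarpingFunction J₂ M₂)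
    (hφ₁ : ContMDiff I₁ J₁ ∞ φ₁) (hφ₂ : ContMDiff I₂ J₂ ∞ φ₂) (p : N₁ × N₂)
    (u : TangentSpace (J₁.prod J₂) (Prod.map φ₁ φ₂ p)) (v : TangentSpace (I₁.prod I₂) p) :
    (doublyWarped k₁ k₂ ρ₁ ρ₂).inner (Prod.map φ₁ φ₂ p) u
        (mfderiv (I₁.prod I₂) (J₁.prod J₂) (Prod.map φ₁ φ₂) p v) =
      ρ₂.toFun (φ₂ p.2) ^ 2 * k₁.inner (φ₁ p.1) u.1 (mfderiv I₁ J₁ φ₁ p.1 v.1) +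
      ρ₁.toFun (φ₁ p.1) ^ 2 * k₂.inner (φ₂ p.2) u.2 (mfderiv I₂ J₂ φ₂ p.2 v.2) := by
  rw [mfderiv_prodMap_apply hφ₁ hφ₂]
  exact doublyWarped_apply k₁ k₂ ρ₁ ρ₂ (φ₁ p.1, φ₂ p.2) u
    (mfderiv I₁ J₁ φ₁ p.1 v.1, mfderiv I₂ J₂ φ₂ p.2 v.2)

theorem IsNormalField.slice_fst {U : Set (N₁ × N₂)}
    {η : ∀ q : N₁ × N₂, TangentSpace (J₁.prod J₂) (Prod.map φ₁ φ₂ q)}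
    (hφ₁ : ContMDiff I₁ J₁ ∞ φ₁) (hφ₂ : ContMDiff I₂ J₂ ∞ φ₂)
    (h : IsNormalField (I := I₁.prod I₂) (doublyWarped k₁ k₂ ρ₁ ρ₂) (Prod.map φ₁ φ₂) U η) (y : N₂) :
    IsNormalField (I := I₁) k₁ φ₁ ((fun x => (x, y)) ⁻¹' U) (fun x => (η (x, y)).1) := by
  refine ⟨?_, fun x hx v => ?_⟩
  · have h₁ : ContMDiff (J₁.prod J₂).tangent J₁.tangent ∞
        (tangentMap (J₁.prod J₂) J₁ (Prod.fst : M₁ × M₂ → M₁)) :=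
      contMDiff_fst.contMDiff_tangentMap (m := ∞) le_rfl
    have h₂ : ContMDiff I₁ (I₁.prod I₂) ∞ (fun x : N₁ => (x, y)) :=
      contMDiff_id.prodMk contMDiff_const
    refine (h₁.comp_contMDiffOn (h.contMDiffOn.comp h₂.contMDiffOn subset_rfl)).congr fun x _ => ?_
    simp only [Function.comp_apply, tangentMap_prodFst]
    rfl
  · have h₁ := h.normal (x, y) hx (v, 0)
    have h₂ := (inner_mfderiv_prodMap k₁ k₂ ρ₁ ρ₂ hφ₁ hφ₂ (x, y) (η (x, y)) (v, 0)).symm.trans h₁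
    have h₃ : k₂.inner (φ₂ y) (η (x, y)).2 (mfderiv I₂ J₂ φ₂ y 0) = 0 := by
      rw [map_zero]
      exact map_zero (k₂.inner (φ₂ y) (η (x, y)).2)
    have h₄ : ρ₂.toFun (φ₂ y) ^ 2 * k₁.inner (φ₁ x) (η (x, y)).1 (mfderiv I₁ J₁ φ₁ x v) +
      ρ₁.toFun (φ₁ x) ^ 2 * 0 = 0 := (congrArg (fun t : ℝ => ρ₂.toFun (φ₂ y) ^ 2 *
        k₁.inner (φ₁ x) (η (x, y)).1 (mfderiv I₁ J₁ φ₁ x v) + ρ₁.toFun (φ₁ x) ^ 2 * t)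
        h₃).symm.trans h₂
    rw [mul_zero, add_zero] at h₄
    exact (mul_eq_zero.1 h₄).resolve_left (pow_ne_zero 2 (ρ₂.pos _).ne')

theorem IsNormalField.slice_snd {U : Set (N₁ × N₂)}
    {η : ∀ q : N₁ × N₂, TangentSpace (J₁.prod J₂) (Prod.map φ₁ φ₂ q)}
    (hφ₁ : ContMDiff I₁ J₁ ∞ φ₁) (hφ₂ : ContMDiff I₂ J₂ ∞ φ₂)
    (h : IsNormalField (I := I₁.prod I₂) (doublyWarped k₁ k₂ ρ₁ ρ₂) (Prod.map φ₁ φ₂) U η) (x : N₁) :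
    IsNormalField (I := I₂) k₂ φ₂ ((fun y => (x, y)) ⁻¹' U) (fun y => (η (x, y)).2) := by
  refine ⟨?_, fun y hy v => ?_⟩
  · have h₁ : ContMDiff (J₁.prod J₂).tangent J₂.tangent ∞
        (tangentMap (J₁.prod J₂) J₂ (Prod.snd : M₁ × M₂ → M₂)) :=
      contMDiff_snd.contMDiff_tangentMap (m := ∞) le_rfl
    have h₂ : ContMDiff I₂ (I₁.prod I₂) ∞ (fun y : N₂ => (x, y)) :=
      contMDiff_const.prodMk contMDiff_id
    refine (h₁.comp_contMDiffOn (h.contMDiffOn.comp h₂.contMDiffOn subset_rfl)).congr fun y _ => ?_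
    simp only [Function.comp_apply, tangentMap_prodSnd]
    rfl
  · have h₁ := h.normal (x, y) hy (0, v)
    have h₂ := (inner_mfderiv_prodMap k₁ k₂ ρ₁ ρ₂ hφ₁ hφ₂ (x, y) (η (x, y)) (0, v)).symm.trans h₁
    have h₃ : k₁.inner (φ₁ x) (η (x, y)).1 (mfderiv I₁ J₁ φ₁ x 0) = 0 := by
      rw [map_zero]
      exact map_zero (k₁.inner (φ₁ x) (η (x, y)).1)
    have h₄ : ρ₂.toFun (φ₂ y) ^ 2 * 0 +
      ρ₁.toFun (φ₁ x) ^ 2 * k₂.inner (φ₂ y) (η (x, y)).2 (mfderiv I₂ J₂ φ₂ y v) = 0 :=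
      (congrArg (fun t : ℝ => ρ₂.toFun (φ₂ y) ^ 2 * t + ρ₁.toFun (φ₁ x) ^ 2 *
        k₂.inner (φ₂ y) (η (x, y)).2 (mfderiv I₂ J₂ φ₂ y v)) h₃).symm.trans h₂
    rw [mul_zero, zero_add] at h₄
    exact (mul_eq_zero.1 h₄).resolve_left (pow_ne_zero 2 (ρ₁.pos _).ne')

theorem IsNormalField.prod_zero {U : Set N₁} {η : ∀ q : N₁, TangentSpace J₁ (φ₁ q)}
    (hφ₁ : ContMDiff I₁ J₁ ∞ φ₁) (hφ₂ : ContMDiff I₂ J₂ ∞ φ₂)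
    (h : IsNormalField (I := I₁) k₁ φ₁ U η) :
    IsNormalField (I := I₁.prod I₂) (doublyWarped k₁ k₂ ρ₁ ρ₂) (Prod.map φ₁ φ₂) (Prod.fst ⁻¹' U)
      (fun q => (η q.1, 0)) := by
  refine ⟨?_, fun q hq v => ?_⟩
  · have h₁ : ContMDiffOn (I₁.prod I₂) J₁.tangent ∞
        (fun q : N₁ × N₂ => (⟨φ₁ q.1, η q.1⟩ : TangentBundle J₁ M₁)) (Prod.fst ⁻¹' U) :=
      h.contMDiffOn.comp contMDiff_fst.contMDiffOn subset_rfl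
    have h₂ : ContMDiff (I₁.prod I₂) J₂.tangent ∞
        (fun q : N₁ × N₂ => (⟨φ₂ q.2, 0⟩ : TangentBundle J₂ M₂)) :=
      (Bundle.contMDiff_zeroSection ℝ (TangentSpace J₂ : M₂ → Type _)).comp
        (hφ₂.comp contMDiff_snd)
    exact (contMDiff_equivTangentBundleProd_symm (I := J₁) (M := M₁) (I' := J₂)
      (M' := M₂)).comp_contMDiffOn (h₁.prodMk h₂.contMDiffOn)
  · refine (inner_mfderiv_prodMap k₁ k₂ ρ₁ ρ₂ hφ₁ hφ₂ q (η q.1, 0) v).trans ?_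
    have h₁ := h.normal q.1 hq v.1
    have h₂ : k₂.inner (φ₂ q.2) 0 (mfderiv I₂ J₂ φ₂ q.2 v.2) = 0 := by rw [map_zero]; rfl
    refine (congrArg₂ (fun s t : ℝ => ρ₂.toFun (φ₂ q.2) ^ 2 * s + ρ₁.toFun (φ₁ q.1) ^ 2 * t)
      h₁ h₂).trans ?_
    simp

theorem IsNormalField.zero_prod {U : Set N₂} {η : ∀ q : N₂, TangentSpace J₂ (φ₂ q)}
    (hφ₁ : ContMDiff I₁ J₁ ∞ φ₁) (hφ₂ : ContMDiff I₂ J₂ ∞ φ₂)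
    (h : IsNormalField (I := I₂) k₂ φ₂ U η) :
    IsNormalField (I := I₁.prod I₂) (doublyWarped k₁ k₂ ρ₁ ρ₂) (Prod.map φ₁ φ₂) (Prod.snd ⁻¹' U)
      (fun q => (0, η q.2)) := by
  refine ⟨?_, fun q hq v => ?_⟩
  · have h₁ : ContMDiffOn (I₁.prod I₂) J₂.tangent ∞
        (fun q : N₁ × N₂ => (⟨φ₂ q.2, η q.2⟩ : TangentBundle J₂ M₂)) (Prod.snd ⁻¹' U) :=
      h.contMDiffOn.comp contMDiff_snd.contMDiffOn subset_rfl
    have h₂ : ContMDiff (I₁.prod I₂) J₁.tangent ∞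
        (fun q : N₁ × N₂ => (⟨φ₁ q.1, 0⟩ : TangentBundle J₁ M₁)) :=
      (Bundle.contMDiff_zeroSection ℝ (TangentSpace J₁ : M₁ → Type _)).comp
        (hφ₁.comp contMDiff_fst)
    exact (contMDiff_equivTangentBundleProd_symm (I := J₁) (M := M₁) (I' := J₂)
      (M' := M₂)).comp_contMDiffOn (h₂.contMDiffOn.prodMk h₁)
  · refine (inner_mfderiv_prodMap k₁ k₂ ρ₁ ρ₂ hφ₁ hφ₂ q (0, η q.2) v).trans ?_
    have h₁ := h.normal q.2 hq v.2
    have h₂ : k₁.inner (φ₁ q.1) 0 (mfderiv I₁ J₁ φ₁ q.1 v.1) = 0 := by rw [map_zero]; rfl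
    refine (congrArg₂ (fun s t : ℝ => ρ₂.toFun (φ₂ q.2) ^ 2 * s + ρ₁.toFun (φ₁ q.1) ^ 2 * t)
      h₂ h₁).trans ?_
    simp

theorem IsTotallyUmbilical.fst_of_prodMap [Nonempty N₂]
    (h₁ : IsIsometricImmersion g₁ k₁ φ₁) (h₂ : IsIsometricImmersion g₂ k₂ φ₂)
    (h : IsTotallyUmbilical
      (doublyWarped g₁ g₂ (ρ₁.comp φ₁ h₁.contMDiff) (ρ₂.comp φ₂ h₂.contMDiff))
      (doublyWarped k₁ k₂ ρ₁ ρ₂) (Prod.map φ₁ φ₂)) :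
    IsTotallyUmbilical g₁ k₁ φ₁ := by
  intro U η hU hη
  obtain ⟨c, hc, hA⟩ := h _ _ (hU.preimage continuous_fst)
    (hη.prod_zero (ρ₁ := ρ₁) (ρ₂ := ρ₂) (k₂ := k₂) h₁.contMDiff h₂.contMDiff)
  obtain ⟨y⟩ := ‹Nonempty N₂›
  refine ⟨fun x => c (x, y), hc.comp (contMDiff_id.prodMk contMDiff_const).contMDiffOn
    fun x hx => hx, fun x hx => ?_⟩
  rw [shapeOperator_eq_smul_id_iff]
  intro v w
  have e₁ := (shapeOperator_eq_smul_id_iff _ _ _ _ _ _).1 (hA (x, y) hx) (v, 0) (w, 0)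
  have e₂ := inner_secondFundamentalForm_prodMap g₁ g₂ k₁ k₂ ρ₁ ρ₂ h₁.contMDiff h₂.contMDiff (x, y)
    (v, 0) (w, 0) (η x, 0) (h₁.isometric x) (h₂.isometric y)
  have e₃ := doublyWarped_apply g₁ g₂ (ρ₁.comp φ₁ h₁.contMDiff) (ρ₂.comp φ₂ h₂.contMDiff) (x, y)
    (v, 0) (w, 0)
  have e₄ := e₂.symm.trans (e₁.trans (congrArg (c (x, y) * ·) e₃))
  have z₁ : g₂.inner y 0 0 = 0 := by simp
  have z₂ : k₂.inner (φ₂ y) (secondFundamentalForm g₂ k₂ φ₂ y 0 0) 0 = 0 := by simp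
  have z₃ : ρ₂.diff (φ₂ y) (normalComponent g₂ k₂ φ₂ y 0) = 0 := by
    rw [normalComponent_zero, map_zero]
  have e₅ : ρ₂.toFun (φ₂ y) ^ 2 * k₁.inner (φ₁ x) (secondFundamentalForm g₁ k₁ φ₁ x v w) (η x) +
      ρ₁.toFun (φ₁ x) ^ 2 * k₂.inner (φ₂ y) (secondFundamentalForm g₂ k₂ φ₂ y 0 0) 0 -
      ρ₂.toFun (φ₂ y) * ρ₂.diff (φ₂ y) (normalComponent g₂ k₂ φ₂ y 0) * g₁.inner x v w -
      ρ₁.toFun (φ₁ x) * ρ₁.diff (φ₁ x) (normalComponent g₁ k₁ φ₁ x (η x)) * g₂.inner y 0 0 =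
      c (x, y) * (ρ₂.toFun (φ₂ y) ^ 2 * g₁.inner x v w + ρ₁.toFun (φ₁ x) ^ 2 * g₂.inner y 0 0) := e₄
  rw [z₁, z₂, z₃] at e₅
  have hne := pow_ne_zero 2 (ρ₂.pos (φ₂ y)).ne'
  apply mul_left_cancel₀ hne
  linarith

theorem IsTotallyUmbilical.snd_of_prodMap [Nonempty N₁]
    (h₁ : IsIsometricImmersion g₁ k₁ φ₁) (h₂ : IsIsometricImmersion g₂ k₂ φ₂)
    (h : IsTotallyUmbilical
      (doublyWarped g₁ g₂ (ρ₁.comp φ₁ h₁.contMDiff) (ρ₂.comp φ₂ h₂.contMDiff))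
      (doublyWarped k₁ k₂ ρ₁ ρ₂) (Prod.map φ₁ φ₂)) :
    IsTotallyUmbilical g₂ k₂ φ₂ := by
  intro U η hU hη
  obtain ⟨c, hc, hA⟩ := h _ _ (hU.preimage continuous_snd)
    (hη.zero_prod (ρ₁ := ρ₁) (ρ₂ := ρ₂) (k₁ := k₁) h₁.contMDiff h₂.contMDiff)
  obtain ⟨x⟩ := ‹Nonempty N₁›
  refine ⟨fun y => c (x, y), hc.comp (contMDiff_const.prodMk contMDiff_id).contMDiffOn
    fun y hy => hy, fun y hy => ?_⟩
  rw [shapeOperator_eq_smul_id_iff]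
  intro v w
  have e₁ := (shapeOperator_eq_smul_id_iff _ _ _ _ _ _).1 (hA (x, y) hy) (0, v) (0, w)
  have e₂ := inner_secondFundamentalForm_prodMap g₁ g₂ k₁ k₂ ρ₁ ρ₂ h₁.contMDiff h₂.contMDiff (x, y)
    (0, v) (0, w) (0, η y) (h₁.isometric x) (h₂.isometric y)
  have e₃ := doublyWarped_apply g₁ g₂ (ρ₁.comp φ₁ h₁.contMDiff) (ρ₂.comp φ₂ h₂.contMDiff) (x, y)
    (0, v) (0, w)
  have e₄ := e₂.symm.trans (e₁.trans (congrArg (c (x, y) * ·) e₃))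
  have z₁ : g₁.inner x 0 0 = 0 := by simp
  have z₂ : k₁.inner (φ₁ x) (secondFundamentalForm g₁ k₁ φ₁ x 0 0) 0 = 0 := by simp
  have z₃ : ρ₁.diff (φ₁ x) (normalComponent g₁ k₁ φ₁ x 0) = 0 := by
    rw [normalComponent_zero, map_zero]
  have e₅ : ρ₂.toFun (φ₂ y) ^ 2 * k₁.inner (φ₁ x) (secondFundamentalForm g₁ k₁ φ₁ x 0 0) 0 +
      ρ₁.toFun (φ₁ x) ^ 2 * k₂.inner (φ₂ y) (secondFundamentalForm g₂ k₂ φ₂ y v w) (η y) -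
      ρ₂.toFun (φ₂ y) * ρ₂.diff (φ₂ y) (normalComponent g₂ k₂ φ₂ y (η y)) * g₁.inner x 0 0 -
      ρ₁.toFun (φ₁ x) * ρ₁.diff (φ₁ x) (normalComponent g₁ k₁ φ₁ x 0) * g₂.inner y v w =
      c (x, y) * (ρ₂.toFun (φ₂ y) ^ 2 * g₁.inner x 0 0 + ρ₁.toFun (φ₁ x) ^ 2 * g₂.inner y v w) := e₄
  rw [z₁, z₂, z₃] at e₅
  have hne := pow_ne_zero 2 (ρ₁.pos (φ₁ x)).ne'
  apply mul_left_cancel₀ hne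
  linarith

/-- If `φ` is totally umbilical with mean curvature vector `-D ln ρ`, then
`⟨h(v, w), ζ⟩ = -d(ln ρ)(ζ) ⟨v, w⟩` along every normal field `ζ`. -/
theorem IsTotallyUmbilical.inner_secondFundamentalForm_eq [Nontrivial E₁]
    (h : IsTotallyUmbilical g₁ k₁ φ₁)
    (hH : ∀ p, meanCurvature g₁ k₁ φ₁ p =
      -normalGradient g₁ k₁ φ₁ (fun x => Real.log (ρ₁.toFun x)) p)
    {U : Set N₁} {η : ∀ q : N₁, TangentSpace J₁ (φ₁ q)} (hU : IsOpen U)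
    (hη : IsNormalField (I := I₁) k₁ φ₁ U η) {x : N₁} (hx : x ∈ U) (v w : TangentSpace I₁ x) :
    k₁.inner (φ₁ x) (secondFundamentalForm g₁ k₁ φ₁ x v w) (η x) =
      -((ρ₁.toFun (φ₁ x))⁻¹ * ρ₁.diff (φ₁ x) (η x)) * g₁.inner x v w := by
  obtain ⟨c, -, hA⟩ := h U η hU hη
  have hc := (shapeOperator_eq_smul_id_iff _ _ _ _ _ _).1 (hA x hx)
  have ht := inner_meanCurvature_of_umbilical g₁ k₁ φ₁ x (η x) (c x) hc
  rw [hH, map_neg, neg_apply, inner_normalGradient_log,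
    normalComponent_of_normal g₁ k₁ φ₁ x (η x) (hη.normal x hx)] at ht
  rw [hc, ht]

theorem umbilical_terms {r s S₁ S₂ A₁ A₂ B₁ B₂ G₁ G₂ : ℝ} (hr : r ≠ 0) (hs : s ≠ 0)
    (h₁ : S₁ = -(r⁻¹ * A₁) * G₁) (h₂ : S₂ = -(s⁻¹ * A₂) * G₂) (c₁ : B₁ = A₁) (c₂ : B₂ = A₂) :
    s ^ 2 * S₁ + r ^ 2 * S₂ - s * B₂ * G₁ - r * B₁ * G₂ =
      (-(r⁻¹ * A₁) - s⁻¹ * A₂) * (s ^ 2 * G₁ + r ^ 2 * G₂) := by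
  subst h₁ h₂ c₁ c₂
  field_simp
  ring

theorem IsTotallyUmbilical.prodMap [Nontrivial E₁] [Nontrivial E₂]
    (h₁ : IsIsometricImmersion g₁ k₁ φ₁) (h₂ : IsIsometricImmersion g₂ k₂ φ₂)
    (u₁ : IsTotallyUmbilical g₁ k₁ φ₁)
    (m₁ : ∀ p, meanCurvature g₁ k₁ φ₁ p =
      -normalGradient g₁ k₁ φ₁ (fun x => Real.log (ρ₁.toFun x)) p)
    (u₂ : IsTotallyUmbilical g₂ k₂ φ₂)
    (m₂ : ∀ p, meanCurvature g₂ k₂ φ₂ p =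
      -normalGradient g₂ k₂ φ₂ (fun x => Real.log (ρ₂.toFun x)) p) :
    IsTotallyUmbilical
      (doublyWarped g₁ g₂ (ρ₁.comp φ₁ h₁.contMDiff) (ρ₂.comp φ₂ h₂.contMDiff))
      (doublyWarped k₁ k₂ ρ₁ ρ₂) (Prod.map φ₁ φ₂) := by
  intro U η hU hη
  refine ⟨fun q => -((ρ₁.toFun (φ₁ q.1))⁻¹ * ρ₁.diff (φ₁ q.1) (η q).1) -
    (ρ₂.toFun (φ₂ q.2))⁻¹ * ρ₂.diff (φ₂ q.2) (η q).2, ?_, fun q hq => ?_⟩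
  · have a₁ : ContMDiffOn (I₁.prod I₂) 𝓘(ℝ, ℝ) ∞
        (fun q : N₁ × N₂ => ρ₁.diff (φ₁ q.1) (η q).1) U := by
      refine ((ρ₁.comp Prod.fst (contMDiff_fst (J := J₂) (N := M₂))).contMDiff_diff.comp_contMDiffOn
        hη.contMDiffOn).congr fun q _ => ?_
      have e := (ρ₁.diff_comp (contMDiff_fst (J := J₂) (N := M₂)) (Prod.map φ₁ φ₂ q) (η q)).symm
      rw [mfderiv_fst] at e
      exact e
    have a₂ : ContMDiffOn (I₁.prod I₂) 𝓘(ℝ, ℝ) ∞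
        (fun q : N₁ × N₂ => ρ₂.diff (φ₂ q.2) (η q).2) U := by
      refine ((ρ₂.comp Prod.snd (contMDiff_snd (I := J₁) (M := M₁))).contMDiff_diff.comp_contMDiffOn
        hη.contMDiffOn).congr fun q _ => ?_
      have e := (ρ₂.diff_comp (contMDiff_snd (I := J₁) (M := M₁)) (Prod.map φ₁ φ₂ q) (η q)).symm
      rw [mfderiv_snd] at e
      exact e
    have b₁ : ContMDiff (I₁.prod I₂) 𝓘(ℝ, ℝ) ∞
        (fun q : N₁ × N₂ => (ρ₁.toFun (φ₁ q.1))⁻¹) :=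
      (ρ₁.contMDiff.comp (h₁.contMDiff.comp contMDiff_fst)).inv₀ fun q => (ρ₁.pos _).ne'
    have b₂ : ContMDiff (I₁.prod I₂) 𝓘(ℝ, ℝ) ∞
        (fun q : N₁ × N₂ => (ρ₂.toFun (φ₂ q.2))⁻¹) :=
      (ρ₂.contMDiff.comp (h₂.contMDiff.comp contMDiff_snd)).inv₀ fun q => (ρ₂.pos _).ne'
    exact (b₁.contMDiffOn.mul a₁).neg.sub (b₂.contMDiffOn.mul a₂)
  · rw [shapeOperator_eq_smul_id_iff]
    intro v w
    obtain ⟨x, y⟩ := q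
    have ho₁ : IsOpen ((fun x' : N₁ => (x', y)) ⁻¹' U) := hU.preimage (by fun_prop)
    have ho₂ : IsOpen ((fun y' : N₂ => (x, y')) ⁻¹' U) := hU.preimage (by fun_prop)
    have hη₁ := hη.slice_fst h₁.contMDiff h₂.contMDiff y
    have hη₂ := hη.slice_snd h₁.contMDiff h₂.contMDiff x
    have e₁ := u₁.inner_secondFundamentalForm_eq m₁ ho₁ hη₁ hq v.1 w.1
    have e₂ := u₂.inner_secondFundamentalForm_eq m₂ ho₂ hη₂ hq v.2 w.2
    have c₁ := normalComponent_of_normal g₁ k₁ φ₁ x _ (hη₁.normal x hq)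
    have c₂ := normalComponent_of_normal g₂ k₂ φ₂ y _ (hη₂.normal y hq)
    refine (inner_secondFundamentalForm_prodMap g₁ g₂ k₁ k₂ ρ₁ ρ₂ h₁.contMDiff h₂.contMDiff (x, y)
      v w (η (x, y)) (h₁.isometric x) (h₂.isometric y)).trans ?_
    refine Eq.trans ?_ (congrArg (_ * ·) (doublyWarped_apply g₁ g₂ (ρ₁.comp φ₁ h₁.contMDiff)
      (ρ₂.comp φ₂ h₂.contMDiff) (x, y) v w).symm)
    exact umbilical_terms (ρ₁.pos (φ₁ x)).ne' (ρ₂.pos (φ₂ y)).ne' e₁ e₂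
      (congrArg (ρ₁.diff (φ₁ x)) c₁) (congrArg (ρ₂.diff (φ₂ y)) c₂)

end ProductImmersion

end DoublyWarped

theorem mainTheorem2
    {E₁ : Type*} [NormedAddCommGroup E₁] [NormedSpace ℝ E₁] [FiniteDimensional ℝ E₁]
    [Nontrivial E₁]
    {H₁ : Type*} [TopologicalSpace H₁] (I₁ : ModelWithCorners ℝ E₁ H₁) [I₁.Boundaryless]
    {N₁ : Type*} [TopologicalSpace N₁] [ChartedSpace H₁ N₁] [IsManifold I₁ ∞ N₁] [Nonempty N₁]
    {E₂ : Type*} [NormedAddCommGroup E₂] [NormedSpace ℝ E₂] [FiniteDimensional ℝ E₂]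
    [Nontrivial E₂]
    {H₂ : Type*} [TopologicalSpace H₂] (I₂ : ModelWithCorners ℝ E₂ H₂) [I₂.Boundaryless]
    {N₂ : Type*} [TopologicalSpace N₂] [ChartedSpace H₂ N₂] [IsManifold I₂ ∞ N₂] [Nonempty N₂]
    {F₁ : Type*} [NormedAddCommGroup F₁] [NormedSpace ℝ F₁] [FiniteDimensional ℝ F₁]
    {K₁ : Type*} [TopologicalSpace K₁] (J₁ : ModelWithCorners ℝ F₁ K₁) [J₁.Boundaryless]
    {M₁ : Type*} [TopologicalSpace M₁] [ChartedSpace K₁ M₁] [IsManifold J₁ ∞ M₁]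
    {F₂ : Type*} [NormedAddCommGroup F₂] [NormedSpace ℝ F₂] [FiniteDimensional ℝ F₂]
    {K₂ : Type*} [TopologicalSpace K₂] (J₂ : ModelWithCorners ℝ F₂ K₂) [J₂.Boundaryless]
    {M₂ : Type*} [TopologicalSpace M₂] [ChartedSpace K₂ M₂] [IsManifold J₂ ∞ M₂]
    (g₁ : RiemMetric I₁ N₁) (g₂ : RiemMetric I₂ N₂)
    (k₁ : RiemMetric J₁ M₁) (k₂ : RiemMetric J₂ M₂)
    (ρ₁ : WarpingFunction J₁ M₁) (ρ₂ : WarpingFunction J₂ M₂)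
    (φ₁ : N₁ → M₁) (φ₂ : N₂ → M₂)
    (hφ₁ : IsIsometricImmersion g₁ k₁ φ₁) (hφ₂ : IsIsometricImmersion g₂ k₂ φ₂)
    (f₁ : WarpingFunction I₁ N₁) (hf₁ : f₁ = ρ₁.comp φ₁ hφ₁.contMDiff)
    (f₂ : WarpingFunction I₂ N₂) (hf₂ : f₂ = ρ₂.comp φ₂ hφ₂.contMDiff)
    (g : RiemMetric (I₁.prod I₂) (N₁ × N₂)) (hg : g = doublyWarped g₁ g₂ f₁ f₂)
    (k : RiemMetric (J₁.prod J₂) (M₁ × M₂)) (hk : k = doublyWarped k₁ k₂ ρ₁ ρ₂)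
    (φ : N₁ × N₂ → M₁ × M₂) (hφ : φ = Prod.map φ₁ φ₂) :
    (IsTotallyUmbilical g k φ ∧
        ∀ p, meanCurvature g k φ p =
          -(normalGradient g k φ (fun x => Real.log (ρ₁.toFun x.1)) p +
            normalGradient g k φ (fun x => Real.log (ρ₂.toFun x.2)) p)) ↔
      (IsTotallyUmbilical g₁ k₁ φ₁ ∧
        ∀ p, meanCurvature g₁ k₁ φ₁ p =
          -normalGradient g₁ k₁ φ₁ (fun x => Real.log (ρ₁.toFun x)) p) ∧
      (IsTotallyUmbilical g₂ k₂ φ₂ ∧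
        ∀ p, meanCurvature g₂ k₂ φ₂ p =
          -normalGradient g₂ k₂ φ₂ (fun x => Real.log (ρ₂.toFun x)) p) := by
  subst hf₁ hf₂ hg hk hφ
  have hmc := fun p : N₁ × N₂ => meanCurvature_prodMap_eq_iff g₁ g₂ k₁ k₂ ρ₁ ρ₂ hφ₁.contMDiff
    hφ₂.contMDiff p (hφ₁.isometric p.1) (hφ₂.isometric p.2)
  constructor
  · rintro ⟨hu, hm⟩
    obtain ⟨x₀⟩ := ‹Nonempty N₁›
    obtain ⟨y₀⟩ := ‹Nonempty N₂›
    exact ⟨⟨hu.fst_of_prodMap hφ₁ hφ₂, fun x => ((hmc (x, y₀)).1 (hm (x, y₀))).1⟩,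
      hu.snd_of_prodMap hφ₁ hφ₂, fun y => ((hmc (x₀, y)).1 (hm (x₀, y))).2⟩
  · rintro ⟨⟨u₁, m₁⟩, u₂, m₂⟩
    exact ⟨u₁.prodMap hφ₁ hφ₂ m₁ u₂ m₂, fun p => (hmc p).2 ⟨m₁ p.1, m₂ p.2⟩⟩
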